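/- Let $N_n=\{1,\dots,n\}$. Let $\Gamma_S$ be the cone of polymatroids on a finite set $S$ (nonnegative, monotone, submodular $\mathbf h:2^S\to\mathbb R$ with $\mathbf h(\emptyset)=0$), $\Gamma_n=\Gamma_{N_n}$, and let $\Gamma^*_S\subseteq\Gamma_S$ be the set of entropy functions $A\mapsto H(X_A)$ (natural logarithm) of random vectors $(X_i)_{i\in S}$ with finite alphabets. A point or a ray is called entropic if it is in $\Gamma_S^*$, resp. contains a nonzero point of $\Gamma_S^*$. For $1\le n'\le n$ let $U=U_{1,n'}^n$ be the rank-one matroid on $N_n$ in which $1,\dots,n'$ are pairwise parallel and all other elements are loops. For rank functions $\mathbf r_P,\mathbf r_Q$ on $S$, we say that $(P,Q)$ is a 2-dimensional face of $\Gamma_S$ if $\mathbf r_P,\mathbf r_Q$ are linearly independent and $\{a\mathbf r_P+b\mathbf r_Q:a,b\ge 0\}$ is a face of $\Gamma_S$. Write $(a,b)$ for $a\mathbf r_P+b\mathbf r_Q$, $a,b\ge0$, and $\chi_P=\{v\in\mathbb Z: v\ge 2,\ \log v\cdot \mathbf r_P\in\Gamma_S^*\}$. The pair $(P,Q)$ is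 called - all-entropic if $(a,b)$ is entropic for all $a,b>0$; - Matúš-type if $(a,b)$ is entropic whenever $a+b\ge\log v$ and $\log(v-1)<a<\log v$ for some $v\in\chi_P$, and non-entropic whenever $a+b<\log\lceil e^a\rceil$; - Chen–Yeung-type if, for $b>0$, $(a,b)$ is entropic whenever $a=\log v$ with $v\in\chi_P$, and non-entropic whenever $a\ne\log v$ for every positive integer $v$. Let $M$ be a matroid on $N_n$ whose rank function spans an extreme ray of $\Gamma_n$, and suppose that $(M,U)$ is a 2-dimensional face of $\Gamma_n$. For a circuit $C$ of $M$ let $F_C=(M|_C,U|_C)$ be the pair of restrictions to $C$; it is called a restricted face if it is a 2-dimensional face of $\Gamma_C$. Then: 1. $(M,U)$ is all-entropic if $M$ has rank $1$, or if the ray of $M$ is entropic, some $i\in\{1,\dots,n'\}$ is not a loop of $M$, and every restricted face $F_C$, $C$ a circuit of $M$, is all-entropic. 2. $(M,U)$ is Matúš-type if there is a circuit $C$ of $M$ such that $F_C$ is Matúš-type and every restricted face $F_{C'}$, $C'\ne C$ a circuit of $M$, is all-entropic, and moreover every loop of $M$ is a loop of $U$. 3. $(M,U)$ is Chen–Yeung-type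 if some $F_C$, $C$ a circuit of $M$, is Chen–Yeung-type, or if some $F_C$ is Matúš-type and some loop of $M$ is not a loop of $U$. -/

import Mathlib

section PolymatroidFaces

variable {V : Type} [Fintype V] [DecidableEq V]

/-- The polymatroid cone on the ground set `V`: nonnegative, monotone, submodular set functions
vanishing at the empty set. -/
def polymatroidCone (V : Type) [DecidableEq V] : Set (Finset V → ℝ) :=
  {h | h ∅ = 0 ∧ (∀ A, 0 ≤ h A) ∧ (∀ A B, A ⊆ B → h A ≤ h B) ∧
    ∀ A B, h (A ∩ B) + h (A ∪ B) ≤ h A + h B}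

open Classical in
/-- The joint (Shannon, natural logarithm) entropy `H(X_A)` of the subvector indexed by `A` of a
random vector `(X_i)` with finite alphabets `κ i` and joint probability mass function `p`. -/
noncomputable def jointEntropy {κ : V → Type} [∀ i, Fintype (κ i)]
    (p : (∀ i, κ i) → ℝ) (A : Finset V) : ℝ :=
  ∑ y : (∀ i : A, κ i), Real.negMulLog (∑ x with (fun i : A => x i) = y, p x)

/-- The entropy region: all entropy functions of random vectors indexed by `V`
with finite alphabets. -/
def entropyRegion (V : Type) [Fintype V] [DecidableEq V] : Set (Finset V → ℝ) :=
  {h | ∃ (κ : V → Type) (_ : ∀ i, Fintype (κ i)) (p : (∀ i, κ i) → ℝ),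
    (∀ x, 0 ≤ p x) ∧ ∑ x, p x = 1 ∧ h = jointEntropy p}

/-- `P` is nonzero and its ray is a one-dimensional face of the polymatroid cone. -/
def OnExtremeRay (P : Finset V → ℝ) : Prop :=
  P ≠ 0 ∧ IsExposed ℝ (polymatroidCone V) {h | ∃ t : ℝ, 0 ≤ t ∧ h = t • P}

/-- The rays of `P` and `Q` span a two-dimensional face `(P, Q)` of the polymatroid cone. -/
def IsTwoDimFace (P Q : Finset V → ℝ) : Prop :=
  LinearIndependent ℝ ![P, Q] ∧
    IsExposed ℝ (polymatroidCone V) {h | ∃ a b : ℝ, 0 ≤ a ∧ 0 ≤ b ∧ h = a • P + b • Q}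

/-- Some nonzero point of the ray of `P` is entropic. -/
def IsEntropicRay (P : Finset V → ℝ) : Prop :=
  ∃ c : ℝ, 0 < c ∧ c • P ∈ entropyRegion V

/-- The probabilistic characteristic set of `P`. -/
def pCharSet (P : Finset V → ℝ) : Set ℕ :=
  {v | 2 ≤ v ∧ Real.log v • P ∈ entropyRegion V}

/-- The point `(a, b)`, that is `a P + b Q`, is entropic. -/
def EntropicAt (P Q : Finset V → ℝ) (a b : ℝ) : Prop :=
  a • P + b • Q ∈ entropyRegion V

/-- All points `(a, b)` with `a, b > 0` are entropic. -/
def IsAllEntropic (P Q : Finset V → ℝ) : Prop :=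
  ∀ a b : ℝ, 0 < a → 0 < b → EntropicAt P Q a b

/-- `(a, b)` is entropic if `a + b ≥ log v` and `log (v - 1) < a < log v` for some `v` in the
characteristic set of `P`, and is not entropic if `a + b < log ⌈e ^ a⌉`. -/
def IsMatusType (P Q : Finset V → ℝ) : Prop :=
  (∀ v ∈ pCharSet P, ∀ a b : ℝ, 0 ≤ a → 0 ≤ b →
    Real.log v ≤ a + b → Real.log ((v : ℝ) - 1) < a → a < Real.log v → EntropicAt P Q a b) ∧
  (∀ a b : ℝ, 0 ≤ a → 0 ≤ b → a + b < Real.log ⌈Real.exp a⌉₊ → ¬ EntropicAt P Q a b)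

/-- For `b > 0`, `(a, b)` is entropic if `a = log v` for some `v` in the characteristic set of `P`,
and is not entropic if `a` is not the logarithm of a positive integer. -/
def IsChenYeungType (P Q : Finset V → ℝ) : Prop :=
  (∀ v ∈ pCharSet P, ∀ b : ℝ, 0 < b → EntropicAt P Q (Real.log v) b) ∧
  (∀ a b : ℝ, 0 ≤ a → 0 < b → (∀ v : ℕ, 1 ≤ v → a ≠ Real.log v) → ¬ EntropicAt P Q a b)

/-- The restriction of a set function to the ground set `S`. -/
def restrictTo (h : Finset V → ℝ) (S : Finset V) : Finset S → ℝ :=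
  fun A => h (A.map (Function.Embedding.subtype (· ∈ S)))

/-- The rank function of a matroid, as a real-valued function on finite sets. -/
noncomputable def matroidRank (M : Matroid V) : Finset V → ℝ :=
  fun A => ((M.eRk (A : Set V)).toNat : ℝ)

/-- The rank function of the rank-one matroid on `n` elements whose first `n'` elements are
pairwise parallel and whose other elements are loops. -/
def rankOne (n n' : ℕ) : Finset (Fin n) → ℝ :=
  fun A => ((min 1 (A.filter (fun i : Fin n => (i : ℕ) < n')).card : ℕ) : ℝ)

end PolymatroidFaces

/-! Write $U$ as `meet N`. All three claims are governed by how the circuits of $M$ sit relative to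
$N$.

On a circuit with $k$ elements, $M$ restricts to $U_{k-1,k}$ (`circRank`). If $k\ge 3$ and the
circuit meets both $N$ and its complement, the restricted pair is always a face
(`isTwoDimFace_circRank_meet`) and never all-entropic (`not_isAllEntropic_circRank`). The
obstruction is that equalities of entropies are independence and determination statements. For
$j\notin N$ they make $X_j$ uniform, so that $a=\log m$ (`EntropicAt.exists_eq_log`), except when
$k=3$ and two elements lie in $N$. There they only exclude small positive points. Hence this
exception is the only possible Matúš-type circuit (`IsMatusType.card_eq`).

Claim 1: an extreme ray is connected up to loops. In rank other than one, if $N$ meets the nonloops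
but misses one of them, some circuit with at least three elements is split by $N$
(`OnExtremeRay.exists_isCircuit_three_le_card`), contrary to hypothesis. So $M$ is carried by $N$.
Mixing a large multiple $h$ of an entropic point with a constant vector gives $qh+H(q)U$ with $H(q)$
arbitrarily small, and adding a multiple of $U$ reaches every positive point.

Claim 2: if the Matúš-type circuit is the only split circuit with at least three elements, circuit
exchange and elimination, together with the face hypothesis, show that it contains all nonloops
(`mem_of_forall_isCircuit_eq`). Then $(M,U)$ is the circuit's pair with common loops adjoined.

Claim 3: sums of entropic points are entropic, which gives the positive half for every pair. The
negative half passes from restrictions to $M$. A loop of $M$ lying in $N$ can serve as a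
conditioning variable, which brings the exceptional circuit back under the uniformity argument
(`EntropicAt.exists_eq_log_of_isLoop`). -/

/-! ### Entropy as expected surprisal on an arbitrary finite probability space. -/

section Observations

variable {V : Type} {Ω : Type} {κ : V → Type}

/-- Two outcomes give the same values to all the variables indexed by `A`. -/
def Agree (X : ∀ i, Ω → κ i) (A : Finset V) (ω ω' : Ω) : Prop := ∀ i ∈ A, X i ω = X i ω'

open Classical in
/-- The probability that the variables indexed by `A` take the same values as at `ω`. -/
noncomputable def mass [Fintype Ω] (p : Ω → ℝ) (X : ∀ i, Ω → κ i) (A : Finset V) (ω : Ω) : ℝ :=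
  ∑ ω', if Agree X A ω ω' then p ω' else 0

/-- The entropy of the variables indexed by `A`, as the expectation of the surprisal. -/
noncomputable def obsEntropy [Fintype Ω] (p : Ω → ℝ) (X : ∀ i, Ω → κ i) (A : Finset V) : ℝ :=
  -∑ ω, p ω * Real.log (mass p X A ω)

lemma Agree.refl (X : ∀ i, Ω → κ i) (A : Finset V) (ω : Ω) : Agree X A ω ω := fun _ _ => rfl

lemma Agree.symm {X : ∀ i, Ω → κ i} {A : Finset V} {ω ω' : Ω} (h : Agree X A ω ω') :
    Agree X A ω' ω := fun i hi => (h i hi).symm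

lemma Agree.trans {X : ∀ i, Ω → κ i} {A : Finset V} {ω ω' ω'' : Ω} (h : Agree X A ω ω')
    (h' : Agree X A ω' ω'') : Agree X A ω ω'' := fun i hi => (h i hi).trans (h' i hi)

lemma Agree.mono {X : ∀ i, Ω → κ i} {A B : Finset V} {ω ω' : Ω} (h : Agree X B ω ω')
    (hAB : A ⊆ B) : Agree X A ω ω' := fun i hi => h i (hAB hi)

lemma agree_union [DecidableEq V] {X : ∀ i, Ω → κ i} {A B : Finset V} {ω ω' : Ω} :
    Agree X (A ∪ B) ω ω' ↔ Agree X A ω ω' ∧ Agree X B ω ω' := by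
  simp only [Agree, Finset.mem_union]
  constructor
  · exact fun h => ⟨fun i hi => h i (Or.inl hi), fun i hi => h i (Or.inr hi)⟩
  · rintro ⟨h, h'⟩ i (hi | hi)
    exacts [h i hi, h' i hi]

lemma agree_iff_restrict {X : ∀ i, Ω → κ i} {A : Finset V} {ω ω' : Ω} :
    Agree X A ω ω' ↔ (fun i : A => X i ω') = fun i : A => X i ω := by
  simp only [Agree, funext_iff, Subtype.forall, eq_comm]

variable [Fintype Ω] {p : Ω → ℝ} {X : ∀ i, Ω → κ i}

lemma le_mass (hp : ∀ ω, 0 ≤ p ω) (A : Finset V) (ω : Ω) : p ω ≤ mass p X A ω := by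
  classical
  have := Finset.single_le_sum (f := fun ω' => if Agree X A ω ω' then p ω' else 0)
    (fun i _ => by split_ifs; exacts [hp i, le_rfl]) (Finset.mem_univ ω)
  simpa [mass, Agree.refl] using this

lemma mass_pos (hp : ∀ ω, 0 < p ω) (A : Finset V) (ω : Ω) : 0 < mass p X A ω :=
  (hp ω).trans_le (le_mass (fun ω => (hp ω).le) A ω)

lemma mass_congr {A : Finset V} {ω ω' : Ω} (h : Agree X A ω ω') :
    mass p X A ω = mass p X A ω' := by
  classical
  refine Finset.sum_congr rfl fun x _ => if_congr ⟨h.symm.trans, h.trans⟩ rfl rfl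

lemma mass_le_mass (hp : ∀ ω, 0 ≤ p ω) {A B : Finset V} {ω : Ω}
    (h : ∀ ω', Agree X B ω ω' → Agree X A ω ω') : mass p X B ω ≤ mass p X A ω := by
  classical
  refine Finset.sum_le_sum fun x _ => ?_
  by_cases hB : Agree X B ω x
  · simp [hB, h x hB]
  · simp only [hB, if_false]; split_ifs; exacts [hp x, le_rfl]

lemma mass_eq_mass {A B : Finset V} {ω : Ω}
    (h : ∀ ω', Agree X A ω ω' ↔ Agree X B ω ω') : mass p X A ω = mass p X B ω := by
  classical
  exact Finset.sum_congr rfl fun x _ => if_congr (h x) rfl rfl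

/-- Entropy sees only the partition of outcomes that the variables induce, so different families of
variables on one space can be compared through `Agree`. -/
lemma obsEntropy_congr {W : Type} {κ' : W → Type} {Y : ∀ i, Ω → κ' i} {A : Finset V}
    {B : Finset W} (h : ∀ ω ω', Agree X A ω ω' ↔ Agree Y B ω ω') :
    obsEntropy p X A = obsEntropy p Y B := by
  classical
  have : ∀ ω, mass p X A ω = mass p Y B ω := fun ω =>
    Finset.sum_congr rfl fun x _ => if_congr (h ω x) rfl rfl
  simp only [obsEntropy, this]

lemma jointEntropy_eq_obsEntropy [Fintype V] [DecidableEq V] [∀ i, Fintype (κ i)]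
    (q : (∀ i, κ i) → ℝ) (A : Finset V) :
    jointEntropy q A = obsEntropy q (fun i x => x i) A := by
  classical
  unfold jointEntropy obsEntropy
  rw [← Finset.sum_neg_distrib, ← Finset.sum_fiberwise Finset.univ (fun x (i : A) => x i)
    (fun x => -(q x * Real.log (mass q (fun i x => x i) A x)))]
  refine Finset.sum_congr rfl fun y _ => ?_
  rw [Real.negMulLog, ← neg_mul_eq_neg_mul, Finset.sum_mul, ← Finset.sum_neg_distrib]
  refine Finset.sum_congr rfl fun x hx => ?_
  obtain rfl : (fun i : A => x i) = y := by simpa using hx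
  have : mass q (fun i x => x i) A x = ∑ x' with (fun i : A => x' i) = fun i : A => x i, q x' := by
    rw [mass, Finset.sum_filter]
    exact Finset.sum_congr rfl fun x' _ => if_congr agree_iff_restrict rfl rfl
  rw [this]

/-- The random vector `X` on a finite probability space realises an entropy function. -/
lemma obsEntropy_mem_entropyRegion [Fintype V] [DecidableEq V] [∀ i, Finite (κ i)]
    (hp : ∀ ω, 0 ≤ p ω) (hp1 : ∑ ω, p ω = 1) : obsEntropy p X ∈ entropyRegion V := by
  classical
  have (i : V) : Fintype (κ i) := Fintype.ofFinite (κ i)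
  set p' : (∀ i, κ i) → ℝ := fun x => ∑ ω, if (fun i => X i ω) = x then p ω else 0 with hp'
  have push : ∀ F : (∀ i, κ i) → ℝ, ∑ x, p' x * F x = ∑ ω, p ω * F (fun i => X i ω) := by
    intro F
    simp only [hp', Finset.sum_mul]
    rw [Finset.sum_comm]
    refine Finset.sum_congr rfl fun ω _ => ?_
    simp [ite_mul]
  refine ⟨κ, inferInstance, p', fun x => Finset.sum_nonneg fun ω _ => ?_, ?_, ?_⟩
  · split_ifs; exacts [hp ω, le_rfl]
  · simpa [hp1] using push fun _ => 1
  funext A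
  rw [jointEntropy_eq_obsEntropy, obsEntropy, obsEntropy, push]
  congr 1
  refine Finset.sum_congr rfl fun ω _ => ?_
  congr 2
  have := push fun x => if Agree (fun i (x : ∀ i, κ i) => x i) A (fun i => X i ω) x then 1 else 0
  simp only [mul_ite, mul_one, mul_zero] at this
  exact this.symm

/-- Every entropy function is realised on a finite probability space without null outcomes. -/
lemma exists_obsEntropy_eq {V : Type} [Fintype V] [DecidableEq V] {h : Finset V → ℝ}
    (hh : h ∈ entropyRegion V) :
    ∃ (Ω : Type) (_ : Fintype Ω) (κ : V → Type) (_ : ∀ i, Fintype (κ i)) (X : ∀ i, Ω → κ i)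
      (p : Ω → ℝ), (∀ ω, 0 < p ω) ∧ ∑ ω, p ω = 1 ∧ h = obsEntropy p X := by
  classical
  obtain ⟨κ, _, p, hp, hp1, rfl⟩ := hh
  have supp : ∀ F : (∀ i, κ i) → ℝ,
      ∑ ω : {x // 0 < p x}, p ω.1 * F ω.1 = ∑ x, p x * F x := by
    intro F
    rw [← Finset.sum_subtype (Finset.univ.filter (0 < p ·)) (by simp) (fun x => p x * F x)]
    refine Finset.sum_filter_of_ne fun x _ hx => (hp x).lt_of_ne fun h0 => hx ?_
    rw [← h0, zero_mul]
  refine ⟨{x // 0 < p x}, inferInstance, κ, inferInstance, fun i x => x.1 i, fun x => p x.1,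
    fun x => x.2, by simpa [hp1] using supp fun _ => 1, ?_⟩
  funext A
  rw [jointEntropy_eq_obsEntropy, obsEntropy, obsEntropy, ← supp]
  congr 1
  refine Finset.sum_congr rfl fun ω _ => ?_
  congr 2
  have := supp fun x => if Agree (fun i (x : ∀ i, κ i) => x i) A ω.1 x then 1 else 0
  simp only [mul_ite, mul_one, mul_zero] at this
  exact this.symm

end Observations

/-! ### Entropic vectors: sums, restrictions, mixtures, parity codes. -/

section Constructions

variable {V : Type} [DecidableEq V]

/-- The rank function of the rank-one matroid on `V` in which the elements of `N` are pairwise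
parallel and all other elements are loops. -/
def meet (N : Finset V) : Finset V → ℝ := fun A => if (A ∩ N).Nonempty then 1 else 0

variable [Fintype V]

/-- Independent realisations are paired coordinatewise on the product space, where masses multiply
and surprisals add. -/
lemma add_mem_entropyRegion {h h' : Finset V → ℝ} (hh : h ∈ entropyRegion V)
    (hh' : h' ∈ entropyRegion V) : h + h' ∈ entropyRegion V := by
  classical
  obtain ⟨Ω, _, κ, _, X, p, hp, hp1, rfl⟩ := exists_obsEntropy_eq hh
  obtain ⟨Ω', _, κ', _, X', p', hp', hp1', rfl⟩ := exists_obsEntropy_eq hh'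
  set q : Ω × Ω' → ℝ := fun ω => p ω.1 * p' ω.2 with hq
  set Y : ∀ i, Ω × Ω' → κ i × κ' i := fun i ω => (X i ω.1, X' i ω.2) with hY
  have hm : ∀ A ω, mass q Y A ω = mass p X A ω.1 * mass p' X' A ω.2 := by
    intro A ω
    have hA : ∀ ω', Agree Y A ω ω' ↔ Agree X A ω.1 ω'.1 ∧ Agree X' A ω.2 ω'.2 := by
      intro ω'
      simp only [Agree, hY, Prod.mk.injEq]
      exact ⟨fun h => ⟨fun i hi => (h i hi).1, fun i hi => (h i hi).2⟩,
        fun h i hi => ⟨h.1 i hi, h.2 i hi⟩⟩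
    rw [mass, mass, mass, Finset.sum_mul_sum, Fintype.sum_prod_type]
    simp only [hA, hq]
    refine Finset.sum_congr rfl fun x _ => ?_
    refine Finset.sum_congr rfl fun y _ => ?_
    by_cases h1 : Agree X A ω.1 x <;> by_cases h2 : Agree X' A ω.2 y <;> simp [h1, h2]
  have key : obsEntropy p X + obsEntropy p' X' = obsEntropy q Y := by
    funext A
    simp only [Pi.add_apply, obsEntropy, Fintype.sum_prod_type]
    simp only [hm]
    simp only [hq]
    have : ∀ x y, p x * p' y * Real.log (mass p X A x * mass p' X' A y) =
        p x * Real.log (mass p X A x) * p' y + p x * (p' y * Real.log (mass p' X' A y)) := by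
      intro x y
      rw [Real.log_mul (mass_pos hp A x).ne' (mass_pos hp' A y).ne']
      ring
    simp only [this, Finset.sum_add_distrib, ← Finset.mul_sum, ← Finset.sum_mul, hp1, hp1']
    ring
  rw [key]
  refine obsEntropy_mem_entropyRegion (fun ω => (mul_pos (hp _) (hp' _)).le) ?_
  simp only [hq, Fintype.sum_prod_type, ← Finset.mul_sum, hp1', mul_one, hp1]

lemma zero_mem_entropyRegion : (0 : Finset V → ℝ) ∈ entropyRegion V := by
  have : obsEntropy (fun _ : Unit => (1 : ℝ)) (fun (_ : V) (_ : Unit) => ()) = 0 := by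
    funext A
    simp [obsEntropy, mass, Agree]
  rw [← this]
  exact obsEntropy_mem_entropyRegion (by simp) (by simp)

lemma nsmul_mem_entropyRegion {h : Finset V → ℝ} (hh : h ∈ entropyRegion V) (k : ℕ) :
    (k : ℝ) • h ∈ entropyRegion V := by
  induction k with
  | zero => simpa using zero_mem_entropyRegion
  | succ k ih =>
    rw [Nat.cast_succ, add_smul, one_smul]
    exact add_mem_entropyRegion ih hh

lemma restrictTo_mem_entropyRegion {h : Finset V → ℝ} (hh : h ∈ entropyRegion V) (S : Finset V) :
    restrictTo h S ∈ entropyRegion S := by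
  obtain ⟨Ω, _, κ, _, X, p, hp, hp1, rfl⟩ := exists_obsEntropy_eq hh
  have : restrictTo (obsEntropy p X) S = obsEntropy p (fun (i : S) => X i) := by
    funext A
    exact obsEntropy_congr fun ω ω' => by simp [Agree]
  rw [this]
  exact obsEntropy_mem_entropyRegion (fun ω => (hp ω).le) hp1

/-- Adjoining constant variables to an entropic vector. -/
lemma mem_entropyRegion_of_restrictTo {h : Finset V → ℝ} {S : Finset V}
    (hS : ∀ A, h A = h (A ∩ S)) (hh : restrictTo h S ∈ entropyRegion S) :
    h ∈ entropyRegion V := by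
  obtain ⟨Ω, _, κ, _, X, p, hp, hp1, he⟩ := exists_obsEntropy_eq hh
  have : h = obsEntropy p
      (fun (i : V) (ω : Ω) => (fun hi => X ⟨i, hi⟩ ω : ∀ hi : i ∈ S, κ ⟨i, hi⟩)) := by
    funext A
    have h1 := congrFun he (A.subtype (· ∈ S))
    rw [restrictTo, Finset.subtype_map, Finset.filter_mem_eq_inter, ← hS] at h1
    rw [h1]
    refine obsEntropy_congr fun ω ω' => ?_
    simp only [Agree, Finset.mem_subtype, Subtype.forall, funext_iff]
    exact ⟨fun h i hi hS => h i hS hi, fun h i hS hi => h i hi hS⟩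
  rw [this]
  exact obsEntropy_mem_entropyRegion (fun ω => (hp ω).le) hp1

/-- Mixing an entropic vector with the constant vector, letting the variables in `N` (among which
are all the nonconstant ones) know which of the two vectors is used. -/
lemma mixture_mem_entropyRegion {h : Finset V → ℝ} (hh : h ∈ entropyRegion V) {N : Finset V}
    (hN : ∀ A, h A = h (A ∩ N)) {q : ℝ} (hq : 0 < q) (hq1 : q ≤ 1) :
    q • h + Real.binEntropy q • meet N ∈ entropyRegion V := by
  classical
  obtain ⟨Ω, _, κ, _, X, p, hp, hp1, he⟩ := exists_obsEntropy_eq hh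
  -- The outcome `none`, of probability `1 - q`, is the constant vector. A variable in `N`
  -- distinguishes it from every `some x`. Variables outside `N` are constant, which loses nothing
  -- by `hN`.
  set Y : ∀ i, Option Ω → Option (κ i) :=
    fun i ω => if i ∈ N then ω.map (X i) else none with hY
  set r : Option Ω → ℝ := fun ω => ω.elim (1 - q) (fun x => q * p x) with hr
  have hr1 : ∑ ω, r ω = 1 := by
    simp [hr, Fintype.sum_option, ← Finset.mul_sum, hp1]
  have key : q • h + Real.binEntropy q • meet N = obsEntropy r Y := by
    funext A
    simp only [Pi.add_apply, Pi.smul_apply, smul_eq_mul, meet]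
    rw [hN A]
    by_cases hA : (A ∩ N).Nonempty
    · obtain ⟨i, hi⟩ := hA
      have hi' := Finset.mem_inter.1 hi
      have a1 : ∀ x, ¬ Agree Y A none (some x) := fun x hx => by
        simpa [hY, hi'.2] using hx i hi'.1
      have a2 : ∀ x, ¬ Agree Y A (some x) none := fun x hx => a1 x hx.symm
      have a3 : ∀ x y, Agree Y A (some x) (some y) ↔ Agree X (A ∩ N) x y := by
        intro x y
        simp only [Agree, hY, Finset.mem_inter, and_imp]
        refine forall₂_congr fun i _ => ?_
        by_cases hi : i ∈ N <;> simp [hi]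
      have m1 : mass r Y A none = 1 - q := by
        simp [mass, Fintype.sum_option, a1, Agree.refl, hr]
      have m2 : ∀ x, mass r Y A (some x) = q * mass p X (A ∩ N) x := by
        intro x
        simp [mass, Fintype.sum_option, a2, a3, hr, Finset.mul_sum]
      have m3 : ∀ x, q * p x * Real.log (q * mass p X (A ∩ N) x) =
          p x * (q * Real.log q) + q * (p x * Real.log (mass p X (A ∩ N) x)) := by
        intro x
        rw [Real.log_mul hq.ne' (mass_pos hp _ x).ne']
        ring
      rw [if_pos ⟨i, hi⟩, he, obsEntropy, obsEntropy, Fintype.sum_option, m1]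
      simp only [m2]
      simp only [hr, Option.elim_none, Option.elim_some, m3, Finset.sum_add_distrib,
        ← Finset.mul_sum, ← Finset.sum_mul, hp1, Real.binEntropy, Real.log_inv]
      ring
    · rw [if_neg hA, Finset.not_nonempty_iff_eq_empty.1 hA, he]
      have hm : ∀ ω, mass r Y A ω = 1 := by
        intro ω
        have : ∀ ω', Agree Y A ω ω' := by
          intro ω' i hi
          have : i ∉ N := fun hi' => hA ⟨i, Finset.mem_inter.2 ⟨hi, hi'⟩⟩
          simp [hY, this]
        simp [mass, this, hr1]
      have hm' : ∀ ω, mass p X ∅ ω = 1 := fun ω => by simp [mass, Agree, hp1]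
      simp [obsEntropy, hm, hm']
  rw [key]
  refine obsEntropy_mem_entropyRegion ?_ hr1
  rintro (_ | ω)
  · simpa [hr] using hq1
  · exact (mul_pos hq (hp ω)).le

/-- Variables in `N` share one source of entropy `b`. A single bit supplies at most `log 2`, so `b`
is split into `k` equal parts, each the binary entropy of some `q`. A shared bit is a mixture with
`h = 0`. -/
lemma smul_meet_mem_entropyRegion (N : Finset V) {b : ℝ} (hb : 0 ≤ b) :
    b • meet N ∈ entropyRegion V := by
  rcases hb.eq_or_lt with rfl | hb
  · simpa using zero_mem_entropyRegion
  obtain ⟨k, hk⟩ := exists_nat_gt (b / Real.log 2)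
  have h2 : 0 < Real.log 2 := Real.log_pos one_lt_two
  have hk0 : (0 : ℝ) < k := (div_pos hb h2).trans hk
  have hbk : b / k ≤ Real.log 2 := by
    rw [div_lt_iff₀ h2] at hk
    rw [div_le_iff₀ hk0]
    linarith
  obtain ⟨q, hq, hqb⟩ := intermediate_value_Icc (show (0 : ℝ) ≤ 2⁻¹ by norm_num)
    Real.binEntropy_continuous.continuousOn
    (show b / k ∈ Set.Icc (Real.binEntropy 0) (Real.binEntropy 2⁻¹) by
      simpa using ⟨(div_pos hb hk0).le, hbk⟩)
  have hq0 : 0 < q := hq.1.lt_of_ne fun h => by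
    rw [← h, Real.binEntropy_zero] at hqb
    exact (div_pos hb hk0).ne hqb
  have := nsmul_mem_entropyRegion (mixture_mem_entropyRegion (zero_mem_entropyRegion (V := V))
    (N := N) (fun A => rfl) hq0 (hq.2.trans (by norm_num))) k
  rwa [hqb, smul_zero, zero_add, smul_smul, mul_div_cancel₀ _ hk0.ne'] at this

/-- The rank function of the uniform matroid on `V` which is a circuit. -/
def circRank (V : Type) [Fintype V] : Finset V → ℝ := fun A => (min A.card (Fintype.card V - 1) : ℕ)

/-- The uniform distribution on the binary vectors of even weight. -/
lemma log_two_smul_circRank_mem_entropyRegion [Nonempty V] :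
    Real.log 2 • circRank V ∈ entropyRegion V := by
  classical
  let Ω : AddSubgroup (V → ZMod 2) :=
    { carrier := {x | ∑ i, x i = 0}
      zero_mem' := by simp
      add_mem' := fun {x y} hx hy => by
        simp only [Set.mem_ofPred_eq, Pi.add_apply, Finset.sum_add_distrib] at *
        rw [hx, hy, add_zero]
      neg_mem' := fun {x} hx => by
        simp only [Set.mem_ofPred_eq, Pi.neg_apply, Finset.sum_neg_distrib] at *
        rw [hx, neg_zero] }
  let X : ∀ _ : V, Ω → ZMod 2 := fun i x => x.1 i
  let p : Ω → ℝ := fun _ => (Fintype.card Ω : ℝ)⁻¹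
  have hΩ : (0 : ℝ) < Fintype.card Ω := Nat.cast_pos.2 Fintype.card_pos
  have hp1 : ∑ ω, p ω = 1 := by
    simp [p, hΩ.ne']
  -- Forgetting a coordinate removes the parity constraint: restriction to a proper `A` is a
  -- surjective homomorphism, its fibres have equal size, and the restricted vector is uniform.
  have small : ∀ A : Finset V, A ≠ Finset.univ →
      obsEntropy p X A = A.card * Real.log 2 := by
    intro A hA
    obtain ⟨v, hv⟩ : ∃ v, v ∉ A := by
      by_contra! h
      exact hA (Finset.eq_univ_iff_forall.2 h)
    let f : Ω →+ (A → ZMod 2) :=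
      { toFun := fun x i => x.1 i, map_zero' := rfl, map_add' := fun _ _ => rfl }
    have surj : ∀ y, y ∈ Set.range f := by
      intro y
      let z : V → ZMod 2 := fun i => if h : i ∈ A then y ⟨i, h⟩ else 0
      -- The parity is repaired at `v`, which `A` does not see.
      let w : V → ZMod 2 := z - Pi.single v (∑ i, z i)
      have hw : w ∈ Ω := by
        change ∑ i, w i = 0
        simp [w, Finset.sum_sub_distrib]
      refine ⟨⟨w, hw⟩, funext fun i => ?_⟩
      have : (i : V) ≠ v := fun h => hv (h ▸ i.2)
      simp [f, w, z, this]
    have card : ∀ ω : Ω, (Fintype.card Ω : ℝ) = 2 ^ A.card * ∑ x, if f x = f ω then 1 else 0 := by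
      intro ω
      have h1 := Finset.card_eq_sum_card_fiberwise (s := (Finset.univ : Finset Ω))
        (t := Finset.univ) (f := f) (fun _ _ => by simp)
      have h2 : ∀ y, (Finset.univ.filter fun x => f x = y).card =
          (Finset.univ.filter fun x => f x = f ω).card := fun y =>
        AddMonoidHom.card_fiber_eq_of_mem_range f (surj y) (surj (f ω))
      simp only [h2, Finset.sum_const, smul_eq_mul] at h1
      rw [← Finset.card_univ, h1]
      simp [ZMod.card]
    have hm : ∀ ω, mass p X A ω = (2 ^ A.card)⁻¹ := by
      intro ω
      have : mass p X A ω = (Fintype.card Ω : ℝ)⁻¹ * ∑ x, if f x = f ω then 1 else 0 := by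
        rw [mass, Finset.mul_sum]
        refine Finset.sum_congr rfl fun x _ => ?_
        rw [mul_ite, mul_one, mul_zero]
        exact if_congr agree_iff_restrict rfl rfl
      have hc := card ω
      rw [this]
      field_simp
      linarith
    simp only [obsEntropy, hm, ← Finset.sum_mul, hp1, Real.log_inv, Real.log_pow]
    ring
  have key : Real.log 2 • circRank V = obsEntropy p X := by
    funext A
    simp only [Pi.smul_apply, circRank, smul_eq_mul]
    by_cases hA : A = Finset.univ
    · obtain ⟨v⟩ := ‹Nonempty V›
      have hv : Finset.univ.erase v ≠ Finset.univ := fun h => by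
        simpa using Finset.eq_univ_iff_forall.1 h v
      have : obsEntropy p X A = obsEntropy p X (Finset.univ.erase v) := by
        refine obsEntropy_congr fun x y => ⟨fun h => h.mono (by simp [hA]), fun h => ?_⟩
        have hxy : ∀ i, i ≠ v → x.1 i = y.1 i := fun i hi => h i (by simp [hi])
        intro i _
        by_cases hi : i = v
        · have hx : ∑ i, x.1 i = 0 := x.2
          have hy : ∑ i, y.1 i = 0 := y.2
          rw [← Finset.add_sum_erase _ _ (Finset.mem_univ v)] at hx hy
          rw [Finset.sum_congr rfl fun j hj => hxy j (Finset.ne_of_mem_erase hj)] at hx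
          rw [hi]
          exact add_right_cancel (hx.trans hy.symm)
        · exact hxy i hi
      rw [this, small _ hv, hA, Finset.card_erase_of_mem (Finset.mem_univ v), Finset.card_univ,
        min_eq_right (Nat.sub_le _ _), mul_comm]
    · have : A.card < Fintype.card V := Finset.card_lt_univ_of_notMem
        (Classical.not_forall.1 fun h => hA (Finset.eq_univ_iff_forall.2 h)).choose_spec
      rw [small A hA, min_eq_left (by omega), mul_comm]
  rw [key]
  exact obsEntropy_mem_entropyRegion (fun _ => inv_nonneg.2 hΩ.le) hp1

end Constructions

/-! ### What equalities between entropies say about the outcomes. -/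

section Independence

variable {V : Type} {Ω : Type} {κ : V → Type} [Fintype Ω] {p : Ω → ℝ} {X : ∀ i, Ω → κ i}

lemma mass_empty (hp1 : ∑ ω, p ω = 1) (ω : Ω) : mass p X ∅ ω = 1 := by
  simp [mass, Agree, hp1]

lemma obsEntropy_empty (hp1 : ∑ ω, p ω = 1) : obsEntropy p X ∅ = 0 := by
  simp [obsEntropy, mass_empty hp1]

/-- If the variables in `B` are no more uncertain than those in `A ⊆ B`, they are determined by
them. -/
lemma agree_of_obsEntropy_eq (hp : ∀ ω, 0 < p ω) {A B : Finset V} (hAB : A ⊆ B)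
    (h : obsEntropy p X A = obsEntropy p X B) {ω ω' : Ω} (hω : Agree X A ω ω') :
    Agree X B ω ω' := by
  classical
  have hle : ∀ ω, mass p X B ω ≤ mass p X A ω := fun ω =>
    mass_le_mass (fun ω => (hp ω).le) fun ω' h => h.mono hAB
  have h0 : ∑ ω, p ω * (Real.log (mass p X A ω) - Real.log (mass p X B ω)) = 0 := by
    simp only [mul_sub, Finset.sum_sub_distrib]
    simp only [obsEntropy] at h
    linarith
  have h1 := (Finset.sum_eq_zero_iff_of_nonneg fun ω _ => mul_nonneg (hp ω).le
    (sub_nonneg.2 (Real.log_le_log (mass_pos hp B ω) (hle ω)))).1 h0 ω (Finset.mem_univ ω)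
  have h2 : mass p X A ω = mass p X B ω :=
    Real.log_injOn_pos (mass_pos hp A ω) (mass_pos hp B ω)
      (sub_eq_zero.1 ((mul_eq_zero.1 h1).resolve_left (hp ω).ne'))
  by_contra hB
  refine h2.not_gt (Finset.sum_lt_sum (fun x _ => ?_) ⟨ω', Finset.mem_univ _, ?_⟩)
  · by_cases hx : Agree X B ω x
    · simp [hx, hx.mono hAB]
    · simp only [hx, if_false]; split_ifs; exacts [(hp x).le, le_rfl]
  · simpa [hω, hB] using hp ω'

lemma mass_eq_of_obsEntropy_eq (hp : ∀ ω, 0 < p ω) {A B : Finset V} (hAB : A ⊆ B)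
    (h : obsEntropy p X A = obsEntropy p X B) (ω : Ω) : mass p X A ω = mass p X B ω :=
  mass_eq_mass fun _ => ⟨agree_of_obsEntropy_eq hp hAB h, fun h => h.mono hAB⟩

/-- Equality in submodularity is conditional independence: the joint law factors, and all pairs of
conditionally possible values occur together. -/
lemma condIndep_of_obsEntropy_eq [DecidableEq V] (hp : ∀ ω, 0 < p ω) (hp1 : ∑ ω, p ω = 1)
    {A B K : Finset V} (hA : K ⊆ A) (hB : K ⊆ B)
    (h : obsEntropy p X A + obsEntropy p X B = obsEntropy p X (A ∪ B) + obsEntropy p X K) :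
    (∀ ω, mass p X A ω * mass p X B ω = mass p X (A ∪ B) ω * mass p X K ω) ∧
      ∀ ω₁ ω₂, Agree X K ω₁ ω₂ → ∃ ω, Agree X A ω₁ ω ∧ Agree X B ω₂ ω := by
  classical
  have mA := mass_pos (X := X) hp A
  have mB := mass_pos (X := X) hp B
  have mAB := mass_pos (X := X) hp (A ∪ B)
  have mK := mass_pos (X := X) hp K
  -- The hypothesis says that $E\log t=0$. Expanding the two masses in the numerator gives
  -- $E\,t=\sum p_1p_2\,g\le\sum p_1p_2\,k=1$, while $E(t-1-\log t)\ge 0$ gives $E\,t\ge 1$. So both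
  -- inequalities are equalities pointwise: $t=1$ is the factorisation, and $g=k$ forces a common
  -- outcome wherever $k>0$.
  set t : Ω → ℝ := fun ω => mass p X A ω * mass p X B ω / (mass p X (A ∪ B) ω * mass p X K ω)
    with ht
  have tpos : ∀ ω, 0 < t ω := fun ω =>
    div_pos (mul_pos (mA ω) (mB ω)) (mul_pos (mAB ω) (mK ω))
  set g : Ω → Ω → ℝ := fun ω₁ ω₂ => ∑ ω, if Agree X A ω ω₁ ∧ Agree X B ω ω₂ then
    p ω / (mass p X (A ∪ B) ω * mass p X K ω) else 0 with hg
  set k : Ω → Ω → ℝ := fun ω₁ ω₂ => if Agree X K ω₁ ω₂ then (mass p X K ω₁)⁻¹ else 0 with hk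
  have gk : ∀ ω₁ ω₂, g ω₁ ω₂ ≤ k ω₁ ω₂ := by
    intro ω₁ ω₂
    by_cases hex : ∃ ω, Agree X A ω ω₁ ∧ Agree X B ω ω₂
    · obtain ⟨ω, h1, h2⟩ := hex
      have hK : Agree X K ω₁ ω₂ := (h1.mono hA).symm.trans (h2.mono hB)
      have : g ω₁ ω₂ = ∑ ω', (if Agree X (A ∪ B) ω ω' then p ω' else 0) /
          (mass p X (A ∪ B) ω * mass p X K ω) := by
        refine Finset.sum_congr rfl fun ω' _ => ?_
        by_cases hω' : Agree X (A ∪ B) ω ω'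
        · have h3 := agree_union.1 hω'
          rw [if_pos ⟨h3.1.symm.trans h1, h3.2.symm.trans h2⟩, if_pos hω', mass_congr hω',
            mass_congr (h3.1.mono hA)]
        · rw [if_neg hω', zero_div, if_neg]
          exact fun h3 => hω' (agree_union.2 ⟨h1.trans h3.1.symm, h2.trans h3.2.symm⟩)
      rw [this, ← Finset.sum_div]
      change mass p X (A ∪ B) ω / _ ≤ _
      rw [hk]
      simp only [hK, if_true]
      rw [← mass_congr (h1.mono hA), div_mul_cancel_left₀ (mAB ω).ne']
    · push Not at hex
      have : g ω₁ ω₂ = 0 := Finset.sum_eq_zero fun ω _ => if_neg fun h => hex ω h.1 h.2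
      rw [this, hk]
      dsimp only
      split_ifs
      exacts [(inv_pos.2 (mK ω₁)).le, le_rfl]
  have sumt : ∑ ω, p ω * t ω = ∑ ω₁, ∑ ω₂, p ω₁ * p ω₂ * g ω₁ ω₂ := by
    have : ∀ ω, p ω * t ω = ∑ ω₁, ∑ ω₂, p ω₁ * p ω₂ *
        (if Agree X A ω ω₁ ∧ Agree X B ω ω₂ then
          p ω / (mass p X (A ∪ B) ω * mass p X K ω) else 0) := by
      intro ω
      have : mass p X A ω * mass p X B ω = ∑ ω₁, ∑ ω₂,
          (if Agree X A ω ω₁ then p ω₁ else 0) * (if Agree X B ω ω₂ then p ω₂ else 0) := by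
        rw [mass, mass, Finset.sum_mul_sum]
      simp only [ht]
      rw [this, Finset.sum_div, Finset.mul_sum]
      refine Finset.sum_congr rfl fun ω₁ _ => ?_
      rw [Finset.sum_div, Finset.mul_sum]
      refine Finset.sum_congr rfl fun ω₂ _ => ?_
      by_cases h1 : Agree X A ω ω₁ <;> by_cases h2 : Agree X B ω ω₂ <;> simp [h1, h2]
      ring
    simp only [this]
    rw [Finset.sum_comm]
    refine Finset.sum_congr rfl fun ω₁ _ => ?_
    rw [Finset.sum_comm]
    refine Finset.sum_congr rfl fun ω₂ _ => ?_
    rw [hg, Finset.mul_sum]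
  have sumk : ∑ ω₁, ∑ ω₂, p ω₁ * p ω₂ * k ω₁ ω₂ = 1 := by
    rw [← hp1]
    refine Finset.sum_congr rfl fun ω₁ _ => ?_
    have : ∀ ω₂, p ω₁ * p ω₂ * k ω₁ ω₂ =
        p ω₁ * (mass p X K ω₁)⁻¹ * if Agree X K ω₁ ω₂ then p ω₂ else 0 := by
      intro ω₂
      simp only [hk]
      split_ifs <;> ring
    simp only [this]
    rw [← Finset.mul_sum]
    change _ * mass p X K ω₁ = _
    rw [inv_mul_cancel_right₀ (mK ω₁).ne']
  have logt : ∑ ω, p ω * Real.log (t ω) = 0 := by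
    have : ∀ ω, p ω * Real.log (t ω) = p ω * Real.log (mass p X A ω) +
        p ω * Real.log (mass p X B ω) - p ω * Real.log (mass p X (A ∪ B) ω) -
        p ω * Real.log (mass p X K ω) := by
      intro ω
      rw [ht, Real.log_div (mul_pos (mA ω) (mB ω)).ne' (mul_pos (mAB ω) (mK ω)).ne',
        Real.log_mul (mA ω).ne' (mB ω).ne', Real.log_mul (mAB ω).ne' (mK ω).ne']
      ring
    simp only [this, Finset.sum_add_distrib, Finset.sum_sub_distrib]
    simp only [obsEntropy] at h
    linarith
  have d1 : ∀ ω, 0 ≤ p ω * (t ω - 1 - Real.log (t ω)) := fun ω =>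
    mul_nonneg (hp ω).le (sub_nonneg.2 (Real.log_le_sub_one_of_pos (tpos ω)))
  have d2 : ∀ ω₁ ω₂, 0 ≤ p ω₁ * p ω₂ * (k ω₁ ω₂ - g ω₁ ω₂) := fun ω₁ ω₂ =>
    mul_nonneg (mul_pos (hp _) (hp _)).le (sub_nonneg.2 (gk _ _))
  have s1 : ∑ ω, p ω * (t ω - 1 - Real.log (t ω)) = ∑ ω, p ω * t ω - 1 := by
    simp only [mul_sub, Finset.sum_sub_distrib, mul_one, hp1, logt, sub_zero]
  have s2 : ∑ ω₁, ∑ ω₂, p ω₁ * p ω₂ * (k ω₁ ω₂ - g ω₁ ω₂) = 1 - ∑ ω, p ω * t ω := by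
    simp only [mul_sub, Finset.sum_sub_distrib]
    rw [sumk, sumt]
  have n1 := Finset.sum_nonneg fun ω (_ : ω ∈ Finset.univ) => d1 ω
  have n2 := Finset.sum_nonneg fun ω₁ (_ : ω₁ ∈ Finset.univ) =>
    Finset.sum_nonneg fun ω₂ (_ : ω₂ ∈ Finset.univ) => d2 ω₁ ω₂
  constructor
  · intro ω
    have h0 := (Finset.sum_eq_zero_iff_of_nonneg fun ω _ => d1 ω).1 (by linarith) ω
      (Finset.mem_univ ω)
    have h1 : t ω = 1 := by
      by_contra hne
      have := Real.log_lt_sub_one_of_pos (tpos ω) hne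
      exact (mul_pos (hp ω) (sub_pos.2 this)).ne' h0
    exact (div_eq_one_iff_eq (mul_pos (mAB ω) (mK ω)).ne').1 h1
  · intro ω₁ ω₂ hK
    have h0 := (Finset.sum_eq_zero_iff_of_nonneg fun ω₁ _ =>
      Finset.sum_nonneg fun ω₂ (_ : ω₂ ∈ Finset.univ) => d2 ω₁ ω₂).1 (by linarith) ω₁
      (Finset.mem_univ ω₁)
    have h1 := (Finset.sum_eq_zero_iff_of_nonneg fun ω₂ _ => d2 ω₁ ω₂).1 h0 ω₂
      (Finset.mem_univ ω₂)
    have h2 := sub_eq_zero.1 ((mul_eq_zero.1 h1).resolve_left (mul_pos (hp _) (hp _)).ne')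
    by_contra! hex
    have : g ω₁ ω₂ = 0 := Finset.sum_eq_zero fun ω _ =>
      if_neg fun h => hex ω h.1.symm h.2.symm
    rw [this, hk] at h2
    simp only [hK, if_true] at h2
    exact (inv_pos.2 (mK ω₁)).ne' h2

/-- A variable all of whose values are equally likely. -/
lemma obsEntropy_singleton_of_mass_const (hp1 : ∑ ω, p ω = 1) {j : V} {c : ℝ}
    (hc : ∀ ω, mass p X {j} ω = c) : ∃ m : ℕ, 1 ≤ m ∧ obsEntropy p X {j} = Real.log m := by
  classical
  -- Each attained value has probability `c`, so `c` is the inverse of the number of values.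
  have hsum : ∑ y ∈ Finset.univ.image (X j), c = 1 := by
    rw [← hp1, ← Finset.sum_fiberwise_of_maps_to (g := X j) (t := Finset.univ.image (X j))
      (fun ω _ => Finset.mem_image_of_mem _ (Finset.mem_univ ω))]
    refine Finset.sum_congr rfl fun y hy => ?_
    obtain ⟨ω, -, rfl⟩ := Finset.mem_image.1 hy
    rw [← hc ω, mass, Finset.sum_filter]
    exact Finset.sum_congr rfl fun x _ => if_congr (by simp [Agree, eq_comm]) rfl rfl
  rw [Finset.sum_const, nsmul_eq_mul] at hsum
  set m := (Finset.univ.image (X j)).card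
  have hm : m ≠ 0 := fun h => by simp [h] at hsum
  refine ⟨m, Nat.one_le_iff_ne_zero.2 hm, ?_⟩
  have : c = (m : ℝ)⁻¹ := eq_inv_of_mul_eq_one_right hsum
  simp [obsEntropy, hc, ← Finset.sum_mul, hp1, this]

variable [DecidableEq V]

/-- Conditions on an entropy function under which the `j`-th variable is uniformly distributed. -/
lemma exists_eq_log_of_mem_entropyRegion [Fintype V] {h : Finset V → ℝ} (hh : h ∈ entropyRegion V)
    {i j l : V} {K : Finset V}
    (h1 : h {j} + h ({i} ∪ K) = h ({j, i} ∪ K))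
    (h2 : h ({j} ∪ K) + h ({l} ∪ K) = h ({j, l} ∪ K) + h K)
    (h3 : h ({l} ∪ K) + h ({i} ∪ K) = h ({l, i} ∪ K) + h K)
    (h4 : h ({j, i} ∪ K) = h ({j, l, i} ∪ K)) (h5 : h ({l, i} ∪ K) = h ({j, l, i} ∪ K)) :
    ∃ m : ℕ, 1 ≤ m ∧ h {j} = Real.log m := by
  obtain ⟨Ω, _, κ, _, X, p, hp, hp1, rfl⟩ := exists_obsEntropy_eq hh
  have u1 : {j} ∪ ({i} ∪ K) = {j, i} ∪ K := by ext; simp; tauto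
  have u2 : ({j} ∪ K) ∪ ({l} ∪ K) = {j, l} ∪ K := by ext; simp; tauto
  have u3 : ({l} ∪ K) ∪ ({i} ∪ K) = {l, i} ∪ K := by ext; simp; tauto
  obtain ⟨m1, s1⟩ := condIndep_of_obsEntropy_eq (A := {j}) (B := {i} ∪ K) (K := ∅) hp hp1
    (by simp) (by simp) (by rw [u1, obsEntropy_empty hp1, add_zero, h1])
  obtain ⟨m2, s2⟩ := condIndep_of_obsEntropy_eq (A := {j} ∪ K) (B := {l} ∪ K) (K := K) hp hp1
    Finset.subset_union_right Finset.subset_union_right (by rw [u2, h2])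
  obtain ⟨m3, -⟩ := condIndep_of_obsEntropy_eq (A := {l} ∪ K) (B := {i} ∪ K) (K := K) hp hp1
    Finset.subset_union_right Finset.subset_union_right (by rw [u3, h3])
  have m4 := mass_eq_of_obsEntropy_eq hp (by intro x; simp; tauto) h4
  have m5 := mass_eq_of_obsEntropy_eq hp (by intro x; simp; tauto) h5
  simp only [u1, u3, mass_empty hp1, mul_one] at m1 m3
  obtain ⟨ω₀, -⟩ : ∃ ω₀, ω₀ ∈ (Finset.univ : Finset Ω) := by
    by_contra! h
    rw [Finset.sum_eq_zero fun ω hω => (h ω hω).elim] at hp1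
    exact zero_ne_one hp1
  -- The factorisations combine to $m_j\,m_K=m_{lK}$ at each outcome. The value of $X_j$ at `ω₁`
  -- occurs together with the values of $X_l,X_K$ at the fixed `ω₀`: it is first joined to $X_K$
  -- using `s1`, then to $X_l$ using `s2`. Hence $m_j$ is the same for all `ω₁`.
  refine obsEntropy_singleton_of_mass_const hp1
    (c := mass p X ({l} ∪ K) ω₀ / mass p X K ω₀) fun ω₁ => ?_
  obtain ⟨ω₂, hj, hK⟩ := s1 ω₁ ω₀ (by simp [Agree])
  obtain ⟨ω, hj', hl⟩ := s2 ω₂ ω₀ (hK.symm.mono Finset.subset_union_right)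
  have pI := mass_pos (X := X) hp ({i} ∪ K) ω
  have pK := mass_pos (X := X) hp K ω
  rw [mass_congr hj, mass_congr (hj'.mono Finset.subset_union_left), mass_congr hl,
    mass_congr (hl.mono Finset.subset_union_right), eq_div_iff pK.ne']
  have e1 := m1 ω
  have e3 := m3 ω
  rw [m5 ω, ← m4 ω, ← e1] at e3
  refine mul_right_cancel₀ pI.ne' ?_
  linarith

/-- If three variables determine one another pairwise and the first one is independent of each of
the other two, then it is constant or the other two have entropy at least `log 2`. -/
lemma eq_zero_or_log_two_le_of_mem_entropyRegion [Fintype V] {h : Finset V → ℝ}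
    (hh : h ∈ entropyRegion V) {i j l : V}
    (h1 : h {j} + h {i} = h {j, i}) (h2 : h {j} + h {l} = h {j, l})
    (h3 : h {j, i} = h {j, i, l}) (h4 : h {j, l} = h {j, i, l}) (h5 : h {i, l} = h {j, i, l}) :
    h {j} = 0 ∨ Real.log 2 ≤ h {l} := by
  obtain ⟨Ω, _, κ, _, X, p, hp, hp1, rfl⟩ := exists_obsEntropy_eq hh
  obtain ⟨m1, -⟩ := condIndep_of_obsEntropy_eq (A := {j}) (B := {i}) (K := ∅) hp hp1
    (by simp) (by simp) (by rw [obsEntropy_empty hp1, add_zero, h1]; rfl)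
  obtain ⟨m2, s2⟩ := condIndep_of_obsEntropy_eq (A := {j}) (B := {l}) (K := ∅) hp hp1
    (by simp) (by simp) (by rw [obsEntropy_empty hp1, add_zero, h2]; rfl)
  have m3 := mass_eq_of_obsEntropy_eq hp (by intro x; simp; tauto) h3
  have m4 := mass_eq_of_obsEntropy_eq hp (by intro x; simp; tauto) h4
  have a5 := fun ω ω' => agree_of_obsEntropy_eq (ω := ω) (ω' := ω') hp
    (by intro x; simp; tauto) h5
  simp only [mass_empty hp1, mul_one] at m1 m2
  change ∀ ω, _ = mass p X {j, i} ω at m1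
  change ∀ ω, _ = mass p X {j, l} ω at m2
  have mil : ∀ ω, mass p X {i} ω = mass p X {l} ω := fun ω =>
    mul_left_cancel₀ (mass_pos hp {j} ω).ne' ((m1 ω).trans ((m3 ω).trans ((m4 ω).symm.trans
      (m2 ω).symm)))
  by_cases hconst : ∀ ω ω', Agree X {j} ω ω'
  · left
    rw [← obsEntropy_empty (X := X) hp1]
    exact obsEntropy_congr fun ω ω' => ⟨fun _ => by simp [Agree], fun _ => hconst ω ω'⟩
  right
  push Not at hconst
  obtain ⟨ω₁, ω₂, hne⟩ := hconst
  -- Two values of $X_j$ both occur with the given value of $X_l$. Since $X_i,X_l$ determine $X_j$,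
  -- the values of $X_i$ differ there. Each of them has the mass of the value of $X_l$ by `mil`, and
  -- the two masses sum to at most 1.
  have half : ∀ ω, mass p X {l} ω ≤ 2⁻¹ := by
    classical
    intro ω
    obtain ⟨x₁, hx₁, hl₁⟩ := s2 ω₁ ω (by simp [Agree])
    obtain ⟨x₂, hx₂, hl₂⟩ := s2 ω₂ ω (by simp [Agree])
    have hi : ¬ Agree X {i} x₁ x₂ := by
      intro hi
      have : Agree X {i, l} x₁ x₂ := (agree_union (A := {i}) (B := {l})).2 ⟨hi, hl₁.symm.trans hl₂⟩
      exact hne (hx₁.trans (((a5 _ _ this).mono (by simp)).trans hx₂.symm))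
    have : mass p X {i} x₁ + mass p X {i} x₂ ≤ 1 := by
      rw [← hp1, mass, mass, ← Finset.sum_add_distrib]
      refine Finset.sum_le_sum fun y _ => ?_
      by_cases h1 : Agree X {i} x₁ y <;> by_cases h2 : Agree X {i} x₂ y
      · exact (hi (h1.trans h2.symm)).elim
      all_goals simp [h1, h2, (hp y).le]
    rw [mil, mil, ← mass_congr hl₁, ← mass_congr hl₂] at this
    linarith
  have : ∑ ω, p ω * Real.log (mass p X {l} ω) ≤ ∑ ω, p ω * Real.log 2⁻¹ :=
    Finset.sum_le_sum fun ω _ => mul_le_mul_of_nonneg_left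
      (Real.log_le_log (mass_pos hp _ ω) (half ω)) (hp ω).le
  rw [← Finset.sum_mul, hp1, one_mul, Real.log_inv] at this
  rw [obsEntropy]
  linarith

end Independence

/-! ### Faces of the polymatroid cone, and the face spanned by a circuit and `meet T`. -/

section Faces

variable {V : Type}

lemma circRank_of_ne_univ [Fintype V] {A : Finset V} (hA : A ≠ Finset.univ) : circRank V A = A.card := by
  have : A.card < Fintype.card V := Finset.card_lt_univ_of_notMem
    (Classical.not_forall.1 fun h => hA (Finset.eq_univ_iff_forall.2 h)).choose_spec
  rw [circRank, min_eq_left (by omega)]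

lemma circRank_univ [Fintype V] : circRank V Finset.univ = (Fintype.card V - 1 : ℕ) := by
  rw [circRank, Finset.card_univ, min_eq_right (by omega)]

variable [DecidableEq V]

/-- Common source of `meet`, `circRank` and the auxiliary summand in `not_isTwoDimFace_of_parallel`.
-/
lemma truncation_mem_polymatroidCone (w : V → ℕ) (k : ℕ) :
    (fun A : Finset V => ((min (∑ i ∈ A, w i) k : ℕ) : ℝ)) ∈ polymatroidCone V := by
  refine ⟨by simp, fun A => Nat.cast_nonneg _, fun A B hAB => ?_, fun A B => ?_⟩
  · exact Nat.cast_le.2 (min_le_min_right _ (Finset.sum_le_sum_of_subset hAB))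
  · have h1 := Finset.sum_union_inter (s₁ := A) (s₂ := B) (f := w)
    have h2 : ∑ i ∈ A ∩ B, w i ≤ ∑ i ∈ A, w i := Finset.sum_le_sum_of_subset Finset.inter_subset_left
    have h3 : ∑ i ∈ A ∩ B, w i ≤ ∑ i ∈ B, w i :=
      Finset.sum_le_sum_of_subset Finset.inter_subset_right
    have : min (∑ i ∈ A ∩ B, w i) k + min (∑ i ∈ A ∪ B, w i) k ≤
        min (∑ i ∈ A, w i) k + min (∑ i ∈ B, w i) k := by omega
    dsimp only
    exact_mod_cast this

lemma meet_mem_polymatroidCone (N : Finset V) : meet N ∈ polymatroidCone V := by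
  convert truncation_mem_polymatroidCone (fun i => if i ∈ N then 1 else 0) 1 using 2 with A
  rw [meet, Finset.sum_boole, Finset.filter_mem_eq_inter]
  split_ifs with h
  · have := Finset.card_pos.2 h
    rw [Nat.cast_id, min_eq_right (by omega), Nat.cast_one]
  · simp [Finset.not_nonempty_iff_eq_empty.1 h]

lemma circRank_mem_polymatroidCone [Fintype V] : circRank V ∈ polymatroidCone V := by
  convert truncation_mem_polymatroidCone (fun _ : V => 1) (Fintype.card V - 1) using 2 with A
  simp [circRank]

lemma smul_add_smul_mem_polymatroidCone {P Q : Finset V → ℝ} (hP : P ∈ polymatroidCone V)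
    (hQ : Q ∈ polymatroidCone V) {a b : ℝ} (ha : 0 ≤ a) (hb : 0 ≤ b) :
    a • P + b • Q ∈ polymatroidCone V := by
  obtain ⟨p0, p1, p2, p3⟩ := hP
  obtain ⟨q0, q1, q2, q3⟩ := hQ
  refine ⟨by simp [p0, q0], fun A => ?_, fun A B hAB => ?_, fun A B => ?_⟩ <;>
    simp only [Pi.add_apply, Pi.smul_apply, smul_eq_mul]
  · exact add_nonneg (mul_nonneg ha (p1 A)) (mul_nonneg hb (q1 A))
  · exact add_le_add (mul_le_mul_of_nonneg_left (p2 A B hAB) ha)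
      (mul_le_mul_of_nonneg_left (q2 A B hAB) hb)
  · linarith [mul_le_mul_of_nonneg_left (p3 A B) ha, mul_le_mul_of_nonneg_left (q3 A B) hb]

/-- Exposed faces of the polymatroid cone are extreme. -/
lemma mem_of_add_mem_of_isExposed {F : Set (Finset V → ℝ)} (hF : IsExposed ℝ (polymatroidCone V) F)
    {f g : Finset V → ℝ} (hf : f ∈ polymatroidCone V) (hg : g ∈ polymatroidCone V)
    (h : f + g ∈ F) : f ∈ F := by
  obtain ⟨l, hl⟩ := hF ⟨_, h⟩
  rw [hl] at h ⊢
  have hz : (0 : Finset V → ℝ) ∈ polymatroidCone V := by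
    simpa using smul_add_smul_mem_polymatroidCone hf hg le_rfl le_rfl
  -- On a cone the maximum of `l` can only be 0, as comparison with 0 and with twice the maximiser
  -- shows. Then `l f` and `l g` both vanish.
  have h2 : (2 : ℝ) • f + (2 : ℝ) • g ∈ polymatroidCone V :=
    smul_add_smul_mem_polymatroidCone hf hg zero_le_two zero_le_two
  have e0 := h.2 0 hz
  have e2 := h.2 _ h2
  have ef := h.2 f hf
  have eg := h.2 g hg
  simp only [map_add, map_smul, map_zero, smul_eq_mul] at e0 e2 ef eg
  exact ⟨hf, fun y hy => (h.2 y hy).trans (by rw [map_add]; linarith)⟩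

lemma meet_of_mem {N A : Finset V} {x : V} (hA : x ∈ A) (hN : x ∈ N) : meet N A = 1 :=
  if_pos ⟨x, Finset.mem_inter.2 ⟨hA, hN⟩⟩

lemma meet_of_disjoint {N A : Finset V} (h : ∀ x ∈ A, x ∉ N) : meet N A = 0 :=
  if_neg fun ⟨x, hx⟩ => h x (Finset.mem_inter.1 hx).1 (Finset.mem_inter.1 hx).2

lemma meet_insert_of_notMem {N A : Finset V} {x : V} (hx : x ∉ N) :
    meet N (insert x A) = meet N A := by
  rw [meet, meet, Finset.insert_inter_of_notMem hx]

variable [Fintype V]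

/-- The polymatroids satisfying with equality all the submodularity and monotonicity inequalities
that are tight for both `P` and `Q` form an exposed face. -/
lemma isExposed_tight (P Q : Finset V → ℝ) : IsExposed ℝ (polymatroidCone V)
    {h ∈ polymatroidCone V | (∀ A B, P A + P B = P (A ∪ B) + P (A ∩ B) →
        Q A + Q B = Q (A ∪ B) + Q (A ∩ B) → h A + h B = h (A ∪ B) + h (A ∩ B)) ∧
      ∀ A B, A ⊆ B → P A = P B → Q A = Q B → h A = h B} := by
  classical
  intro _
  let ev : Finset V → StrongDual ℝ (Finset V → ℝ) := fun A =>
    ContinuousLinearMap.proj (R := ℝ) (φ := fun _ : Finset V => ℝ) A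
  let S : Finset (Finset V × Finset V) := Finset.univ.filter fun x =>
    P x.1 + P x.2 = P (x.1 ∪ x.2) + P (x.1 ∩ x.2) ∧ Q x.1 + Q x.2 = Q (x.1 ∪ x.2) + Q (x.1 ∩ x.2)
  let R : Finset (Finset V × Finset V) := Finset.univ.filter fun x =>
    x.1 ⊆ x.2 ∧ P x.1 = P x.2 ∧ Q x.1 = Q x.2
  -- Minus the total slack of the tight inequalities: nonpositive on the cone, and zero exactly
  -- where all of them are equalities.
  let l : StrongDual ℝ (Finset V → ℝ) :=
    -∑ x ∈ S, (ev x.1 + ev x.2 - (ev (x.1 ∪ x.2) + ev (x.1 ∩ x.2))) -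
      ∑ x ∈ R, (ev x.2 - ev x.1)
  have hl : ∀ h : Finset V → ℝ, l h =
      -∑ x ∈ S, (h x.1 + h x.2 - (h (x.1 ∪ x.2) + h (x.1 ∩ x.2))) - ∑ x ∈ R, (h x.2 - h x.1) := by
    intro h
    simp [l, ev]
  have nS : ∀ h ∈ polymatroidCone V, ∀ x ∈ S,
      0 ≤ h x.1 + h x.2 - (h (x.1 ∪ x.2) + h (x.1 ∩ x.2)) := by
    intro h hh x _
    linarith [hh.2.2.2 x.1 x.2]
  have nR : ∀ h ∈ polymatroidCone V, ∀ x ∈ R, 0 ≤ h x.2 - h x.1 := by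
    intro h hh x hx
    exact sub_nonneg.2 (hh.2.2.1 _ _ (Finset.mem_filter.1 hx).2.1)
  have nonpos : ∀ h ∈ polymatroidCone V, l h ≤ 0 := by
    intro h hh
    rw [hl]
    linarith [Finset.sum_nonneg (nS h hh), Finset.sum_nonneg (nR h hh)]
  have hz : (0 : Finset V → ℝ) ∈ polymatroidCone V := by
    simpa using smul_add_smul_mem_polymatroidCone (meet_mem_polymatroidCone (∅ : Finset V))
      (meet_mem_polymatroidCone (∅ : Finset V)) le_rfl le_rfl
  refine ⟨l, Set.ext fun h => and_congr_right fun hh => ⟨fun ht y hy => ?_, fun hmax => ?_⟩⟩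
  · refine (nonpos y hy).trans_eq ?_
    rw [hl, Finset.sum_eq_zero, Finset.sum_eq_zero, neg_zero, sub_zero]
    · intro x hx
      have := (Finset.mem_filter.1 hx).2
      rw [ht.2 _ _ this.1 this.2.1 this.2.2, sub_self]
    · intro x hx
      have := (Finset.mem_filter.1 hx).2
      rw [ht.1 _ _ this.1 this.2, sub_self]
  · have h0 := hmax 0 hz
    rw [map_zero, hl] at h0
    have s1 := Finset.sum_nonneg (nS h hh)
    have s2 := Finset.sum_nonneg (nR h hh)
    refine ⟨fun A B hP hQ => ?_, fun A B hAB hP hQ => ?_⟩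
    · have := (Finset.sum_eq_zero_iff_of_nonneg (nS h hh)).1 (by linarith) (A, B)
        (Finset.mem_filter.2 ⟨Finset.mem_univ _, hP, hQ⟩)
      exact sub_eq_zero.1 this
    · have := (Finset.sum_eq_zero_iff_of_nonneg (nR h hh)).1 (by linarith) (A, B)
        (Finset.mem_filter.2 ⟨Finset.mem_univ _, hAB, hP, hQ⟩)
      exact (sub_eq_zero.1 this).symm

lemma isTwoDimFace_of_tight {P Q : Finset V → ℝ} (hP : P ∈ polymatroidCone V)
    (hQ : Q ∈ polymatroidCone V) (hPQ : LinearIndependent ℝ ![P, Q])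
    (H : ∀ h ∈ polymatroidCone V, (∀ A B, P A + P B = P (A ∪ B) + P (A ∩ B) →
        Q A + Q B = Q (A ∪ B) + Q (A ∩ B) → h A + h B = h (A ∪ B) + h (A ∩ B)) →
      (∀ A B, A ⊆ B → P A = P B → Q A = Q B → h A = h B) →
      ∃ a b : ℝ, 0 ≤ a ∧ 0 ≤ b ∧ h = a • P + b • Q) : IsTwoDimFace P Q := by
  refine ⟨hPQ, ?_⟩
  convert isExposed_tight P Q using 1
  ext h
  refine ⟨?_, fun hh => H h hh.1 hh.2.1 hh.2.2⟩
  rintro ⟨a, b, ha, hb, rfl⟩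
  refine ⟨smul_add_smul_mem_polymatroidCone hP hQ ha hb, fun A B h1 h2 => ?_,
    fun A B _ h1 h2 => ?_⟩ <;> simp only [Pi.add_apply, Pi.smul_apply, smul_eq_mul]
  · linear_combination a * h1 + b * h2
  · rw [h1, h2]

lemma circRank_erase (v : V) :
    circRank V (Finset.univ.erase v) = circRank V Finset.univ := by
  rw [circRank_univ, circRank, Finset.card_erase_of_mem (Finset.mem_univ v), Finset.card_univ,
    min_self]

/-- The face conditions pin down the polymatroid up to two parameters. -/
lemma exists_eq_smul_add_smul {T : Finset V} {j₀ t₀ : V} (hj₀ : j₀ ∉ T)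
    (ht₀ : t₀ ∈ T) {h : Finset V → ℝ} (hh : h ∈ polymatroidCone V)
    (h1 : ∀ j ∉ T, ∀ A, j ∉ A → insert j A ≠ Finset.univ → h (insert j A) = h A + h {j})
    (h2 : ∀ j ∉ T, h (Finset.univ.erase j) = h Finset.univ)
    (h2' : ∀ i ∈ T, ∀ t ∈ T, i ≠ t → h (Finset.univ.erase i) = h Finset.univ)
    (h3 : ∀ B ⊆ T, B.Nonempty → ∀ i ∈ T, i ∉ B → h (insert i B) + h (T.erase i) = h T + h B) :
    ∃ a b : ℝ, 0 ≤ a ∧ 0 ≤ b ∧ h = a • circRank V + b • meet T := by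
  obtain ⟨h0, hnn, hmono, hsub⟩ := hh
  set a := h {j₀} with ha
  have hne : ∀ v : V, Finset.univ.erase v ≠ Finset.univ := fun v h => by
    simpa using Finset.eq_univ_iff_forall.1 h v
  -- The complements of `j` and of `j₀` both have the full value, and each adds one of the two
  -- elements to the same set.
  have single : ∀ j ∉ T, h {j} = a := by
    intro j hj
    by_cases hjj : j = j₀
    · rw [hjj]
    have e1 : insert j₀ ((Finset.univ.erase j).erase j₀) = Finset.univ.erase j :=
      Finset.insert_erase (by simp [Ne.symm hjj])
    have e2 : insert j ((Finset.univ.erase j).erase j₀) = Finset.univ.erase j₀ := by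
      rw [Finset.erase_right_comm]
      exact Finset.insert_erase (by simp [hjj])
    have f1 := h1 j₀ hj₀ ((Finset.univ.erase j).erase j₀) (by simp) (by rw [e1]; exact hne j)
    have f2 := h1 j hj ((Finset.univ.erase j).erase j₀) (by simp) (by rw [e2]; exact hne j₀)
    rw [e1, h2 j hj] at f1
    rw [e2, h2 j₀ hj₀] at f2
    linarith
  have split : ∀ A : Finset V, A ≠ Finset.univ → h A = h (A ∩ T) + (A \ T).card * a := by
    have aux : ∀ D : Finset V, Disjoint D T → ∀ B ⊆ T, D ∪ B ≠ Finset.univ →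
        h (D ∪ B) = h B + D.card * a := by
      intro D
      induction D using Finset.induction_on with
      | empty => intro _ B _ _; simp
      | insert d D hd ih =>
        intro hD B hB hu
        rw [Finset.disjoint_insert_left] at hD
        rw [Finset.insert_union] at hu ⊢
        have hdB : d ∉ D ∪ B := by
          simp only [Finset.mem_union, not_or]
          exact ⟨hd, fun h => hD.1 (hB h)⟩
        rw [h1 d hD.1 _ hdB hu, ih hD.2 B hB, single d hD.1, Finset.card_insert_of_notMem hd]
        · push_cast; ring
        · intro hu'
          exact hdB (hu' ▸ Finset.mem_univ d)
    intro A hA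
    have := aux (A \ T) Finset.sdiff_disjoint (A ∩ T) Finset.inter_subset_right
      (by rwa [Finset.sdiff_union_inter])
    rwa [Finset.sdiff_union_inter] at this
  -- Comparing the complements of `i` and `j₀` gives `h T - h (T.erase i) = a`, and `h3` transports
  -- this increment to `B`.
  have step : ∀ B ⊆ T, B.Nonempty → ∀ i ∈ T, i ∉ B → h (insert i B) = h B + a := by
    intro B hB hBn i hi hiB
    obtain ⟨t, ht⟩ := hBn
    have hit : i ≠ t := fun h => hiB (h ▸ ht)
    have e1 := split _ (hne i)
    have e2 := split _ (hne j₀)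
    rw [h2' i hi t (hB ht) hit] at e1
    rw [h2 j₀ hj₀] at e2
    have i1 : Finset.univ.erase i ∩ T = T.erase i := by ext; simp
    have i2 : Finset.univ.erase j₀ ∩ T = T := by
      ext x; simp only [Finset.mem_inter, Finset.mem_erase, Finset.mem_univ, and_true]
      exact ⟨fun h => h.2, fun h => ⟨fun h' => hj₀ (h' ▸ h), h⟩⟩
    have i3 : Finset.univ.erase i \ T = Finset.univ \ T := by
      ext x; simp only [Finset.mem_sdiff, Finset.mem_erase, Finset.mem_univ, and_true, true_and]
      exact ⟨fun h => h.2, fun h => ⟨fun h' => h (h' ▸ hi), h⟩⟩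
    have i4 : Finset.univ.erase j₀ \ T = (Finset.univ \ T).erase j₀ := by
      ext x; simp
    have i5 := Finset.card_erase_add_one (s := Finset.univ \ T) (a := j₀) (by simpa using hj₀)
    rw [i1, i3, ← i5] at e1
    rw [i2, i4] at e2
    push_cast at e1
    have := h3 B hB ⟨t, ht⟩ i hi hiB
    linarith
  have same : ∀ t ∈ T, h {t} = h {t₀} := by
    intro t ht
    by_cases htt : t = t₀
    · rw [htt]
    have f1 := step {t} (by simpa using ht) (by simp) t₀ ht₀ (by simpa using Ne.symm htt)
    have f2 := step {t₀} (by simpa using ht₀) (by simp) t ht (by simpa using htt)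
    rw [Finset.pair_comm] at f1
    linarith
  set b := h {t₀} - a with hb
  have onT : ∀ B : Finset V, B.Nonempty → B ⊆ T → h B = B.card * a + b := by
    intro B hB
    induction hB using Finset.Nonempty.cons_induction with
    | singleton t =>
      intro ht
      rw [same t (by simpa using ht)]
      simp [hb]
    | cons i B hi hB ih =>
      intro hBT
      rw [Finset.cons_eq_insert] at hBT ⊢
      rw [Finset.insert_subset_iff] at hBT
      rw [step B hBT.2 hB i hBT.1 hi, ih hBT.2, Finset.card_insert_of_notMem hi]
      push_cast
      ring
  have proper : ∀ A : Finset V, A ≠ Finset.univ → h A = A.card * a + meet T A * b := by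
    intro A hA
    rw [split A hA, ← Finset.card_inter_add_card_sdiff A T]
    by_cases hAT : (A ∩ T).Nonempty
    · rw [onT _ hAT Finset.inter_subset_right, meet, if_pos hAT]
      push_cast; ring
    · rw [meet, if_neg hAT, Finset.not_nonempty_iff_eq_empty.1 hAT, h0]
      push_cast; simp
  refine ⟨a, b, hnn _, ?_, ?_⟩
  -- Nonnegativity of `b` is submodularity on two elements of `T`. If `T` is a singleton, it is
  -- monotonicity at the top instead.
  · by_cases ht : ∃ t ∈ T, t ≠ t₀
    · obtain ⟨t, ht, htt⟩ := ht
      have f1 := step {t₀} (by simpa using ht₀) (by simp) t ht (by simpa using htt)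
      have f2 := hsub {t} {t₀}
      rw [← Finset.insert_eq, f1, Finset.singleton_inter_of_notMem (by simpa using htt), h0,
        same t ht] at f2
      linarith
    · push Not at ht
      have f1 := hmono _ _ (Finset.erase_subset t₀ Finset.univ)
      rw [← h2 j₀ hj₀, proper _ (hne _), proper _ (hne _),
        Finset.card_erase_of_mem (Finset.mem_univ _), Finset.card_erase_of_mem (Finset.mem_univ _),
        meet_of_disjoint (A := Finset.univ.erase t₀)
          (fun x hx hxT => Finset.ne_of_mem_erase hx (ht x hxT)),
        meet_of_mem (x := t₀) (by simp; exact fun h => hj₀ (h ▸ ht₀)) ht₀] at f1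
      linarith
  · funext A
    have main : ∀ A : Finset V, A ≠ Finset.univ → h A = (a • circRank V + b • meet T) A := by
      intro A hA
      rw [proper A hA]
      simp only [Pi.add_apply, Pi.smul_apply, smul_eq_mul, circRank_of_ne_univ hA]
      ring
    by_cases hA : A = Finset.univ
    · rw [hA, ← h2 j₀ hj₀, main _ (hne _)]
      simp only [Pi.add_apply, Pi.smul_apply, smul_eq_mul, circRank_erase]
      rw [meet_of_mem (x := t₀) (Finset.mem_univ _) ht₀,
        meet_of_mem (x := t₀) (by simp; exact fun h => hj₀ (h ▸ ht₀)) ht₀]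
    · exact main A hA

/-- Each hypothesis of `exists_eq_smul_add_smul` is an inequality tight for both `circRank` and
`meet T`, so the tight face is no larger than their span. -/
lemma isTwoDimFace_circRank_meet (hV : 3 ≤ Fintype.card V) {T : Finset V} {j₀ t₀ : V}
    (hj₀ : j₀ ∉ T) (ht₀ : t₀ ∈ T) : IsTwoDimFace (circRank V) (meet T) := by
  have hne : ∀ v : V, Finset.univ.erase v ≠ Finset.univ := fun v h => by
    simpa using Finset.eq_univ_iff_forall.1 h v
  have sing : ∀ v : V, circRank V {v} = 1 := by
    intro v
    rw [circRank, Finset.card_singleton, min_eq_left (by omega), Nat.cast_one]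
  refine isTwoDimFace_of_tight circRank_mem_polymatroidCone (meet_mem_polymatroidCone T) ?_ ?_
  · rw [LinearIndependent.pair_iff]
    intro s t hst
    have e1 := congrFun hst {j₀}
    have e2 := congrFun hst {t₀}
    simp only [Pi.add_apply, Pi.smul_apply, smul_eq_mul, sing, Pi.zero_apply] at e1 e2
    rw [meet_of_disjoint (by simpa using hj₀)] at e1
    rw [meet_of_mem (Finset.mem_singleton_self t₀) ht₀] at e2
    constructor <;> linarith
  · intro h hh hs hm
    have h0 : h ∅ = 0 := hh.1
    have univ_meet : ∀ v t, v ≠ t → t ∈ T →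
        meet T (Finset.univ.erase v) = meet T Finset.univ := by
      intro v t hvt ht
      rw [meet_of_mem (x := t) (by simp [hvt.symm]) ht, meet_of_mem (Finset.mem_univ t) ht]
    refine exists_eq_smul_add_smul hj₀ ht₀ hh ?_ ?_ ?_ ?_
    · intro j hj A hjA hu
      have hA : A ≠ Finset.univ := fun h => hjA (h ▸ Finset.mem_univ j)
      have he : A ∩ {j} = ∅ := Finset.inter_singleton_of_notMem hjA
      have := hs A {j} ?_ ?_
      · rw [Finset.union_singleton, he, h0] at this
        linarith
      · rw [Finset.union_singleton, he, circRank_of_ne_univ hA, circRank_of_ne_univ hu, sing,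
          Finset.card_insert_of_notMem hjA]
        simp [circRank]
      · rw [Finset.union_singleton, he, meet_insert_of_notMem hj,
          meet_of_disjoint (A := {j}) (by simpa using hj), meet_of_disjoint (A := ∅) (by simp)]
    · intro j hj
      exact hm _ _ (Finset.erase_subset _ _) (circRank_erase j)
        (univ_meet j t₀ (fun h => hj (h ▸ ht₀)) ht₀)
    · intro i _ t ht hit
      exact hm _ _ (Finset.erase_subset _ _) (circRank_erase i) (univ_meet i t hit ht)
    · intro B hB hBn i hi hiB
      have e1 : insert i B ∪ T.erase i = T := by
        ext x
        simp only [Finset.mem_union, Finset.mem_insert, Finset.mem_erase]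
        constructor
        · rintro ((rfl | h) | h)
          exacts [hi, hB h, h.2]
        · intro h
          by_cases hx : x = i
          exacts [Or.inl (Or.inl hx), Or.inr ⟨hx, h⟩]
      have e2 : insert i B ∩ T.erase i = B := by
        ext x
        simp only [Finset.mem_inter, Finset.mem_insert, Finset.mem_erase]
        constructor
        · rintro ⟨rfl | h, h'⟩
          exacts [(h'.1 rfl).elim, h]
        · exact fun h => ⟨Or.inr h, fun h' => hiB (h' ▸ h), hB h⟩
      have pr : ∀ S ⊆ T, S ≠ Finset.univ := fun S hS h => hj₀ (hS (h ▸ Finset.mem_univ j₀))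
      obtain ⟨t, ht⟩ := hBn
      have hti : t ≠ i := fun h => hiB (h ▸ ht)
      have := hs (insert i B) (T.erase i) ?_ ?_
      · rwa [e1, e2] at this
      · rw [e1, e2, circRank_of_ne_univ (pr _ (Finset.insert_subset hi hB)),
          circRank_of_ne_univ (pr _ (Finset.erase_subset _ _)), circRank_of_ne_univ (pr _ le_rfl),
          circRank_of_ne_univ (pr _ hB), Finset.card_insert_of_notMem hiB,
          ← Finset.card_erase_add_one hi]
        push_cast
        ring
      · rw [e1, e2, meet_of_mem (Finset.mem_insert_self i B) hi, meet_of_mem hi hi,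
          meet_of_mem ht (hB ht), meet_of_mem (x := t) (by simp [hti, hB ht]) (hB ht)]

end Faces

/-! ### Non-entropic points on the faces of a single circuit. -/

section CircuitFaces

variable {V : Type} [DecidableEq V] [Fintype V]

/-- If `i`, `j`, `l` form a circuit of size three after contracting `K`, where `j ∉ N` and either
`l ∉ N` or `K` meets `N`, then only logarithms of integers occur as first coordinates. -/
lemma EntropicAt.exists_eq_log {P : Finset V → ℝ} {N K : Finset V} {i j l : V} {a b : ℝ}
    (h : EntropicAt P (meet N) a b) (pj : P {j} = 1)
    (pjK : P ({j} ∪ K) = P K + 1) (plK : P ({l} ∪ K) = P K + 1) (piK : P ({i} ∪ K) = P K + 1)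
    (pjl : P ({j, l} ∪ K) = P K + 2) (pji : P ({j, i} ∪ K) = P K + 2)
    (pli : P ({l, i} ∪ K) = P K + 2) (pjli : P ({j, l, i} ∪ K) = P K + 2)
    (hj : j ∉ N) (hl : l ∉ N ∨ ∃ x ∈ K, x ∈ N) : ∃ m : ℕ, 1 ≤ m ∧ a = Real.log m := by
  have qj : meet N {j} = 0 := meet_of_disjoint (by simpa using hj)
  have ev : ∀ A, (a • P + b • meet N) A = a * P A + b * meet N A := fun A => by simp
  have q : meet N ({j} ∪ K) = meet N K ∧ meet N ({l} ∪ K) = meet N K ∧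
      meet N ({j, l} ∪ K) = meet N K ∧ meet N ({j, i} ∪ K) = meet N ({i} ∪ K) ∧
      meet N ({l, i} ∪ K) = meet N ({i} ∪ K) ∧ meet N ({j, l, i} ∪ K) = meet N ({i} ∪ K) := by
    rcases hl with hl | ⟨x, hK, hN⟩
    · simp [Finset.insert_union, meet_insert_of_notMem, hj, hl]
    · have : ∀ S, meet N (S ∪ K) = 1 := fun S => meet_of_mem (Finset.mem_union_right S hK) hN
      simp [this, meet_of_mem hK hN, -Finset.insert_union, -Finset.singleton_union]
  obtain ⟨q1, q2, q3, q4, q5, q6⟩ := q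
  obtain ⟨m, hm, he⟩ := exists_eq_log_of_mem_entropyRegion (i := i) (j := j) (l := l) (K := K) h
    (by rw [ev, ev, ev, pj, piK, pji, qj, q4]; ring)
    (by rw [ev, ev, ev, ev, pjK, plK, pjl, q1, q2, q3]; ring)
    (by rw [ev, ev, ev, ev, plK, piK, pli, q2, q5]; ring)
    (by rw [ev, ev, pji, pjli, q4, q6])
    (by rw [ev, ev, pli, pjli, q5, q6])
  refine ⟨m, hm, ?_⟩
  rw [← he, ev, pj, qj]
  ring

/-- Contracting the complement `K` of `{i, j, l}` turns the circuit into a three-element one, as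
`EntropicAt.exists_eq_log` requires. -/
lemma EntropicAt.exists_eq_log_of_circRank {T : Finset V} {a b : ℝ}
    (h : EntropicAt (circRank V) (meet T) a b) {i j l : V} (hij : i ≠ j) (hil : i ≠ l)
    (hjl : j ≠ l) (hj : j ∉ T) (hl : l ∉ T ∨ ∃ x ∈ T, x ≠ i ∧ x ≠ l) :
    ∃ m : ℕ, 1 ≤ m ∧ a = Real.log m := by
  set K : Finset V := Finset.univ \ {j, l, i} with hK
  have hc : K.card + 3 = Fintype.card V := by
    have h3 : ({j, l, i} : Finset V).card = 3 := by
      rw [Finset.card_eq_three]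
      exact ⟨j, l, i, hjl, hij.symm, hil.symm, rfl⟩
    have := Finset.card_le_univ ({j, l, i} : Finset V)
    rw [hK, Finset.card_sdiff_of_subset (Finset.subset_univ _), h3, Finset.card_univ]
    omega
  have mK : ∀ x, x ∈ K ↔ x ≠ j ∧ x ≠ l ∧ x ≠ i := by simp [hK]
  have c1 : ∀ x, x ∉ K → ({x} ∪ K).card = K.card + 1 := fun x hx => by
    rw [Finset.singleton_union, Finset.card_insert_of_notMem hx]
  have c2 : ∀ x y, x ≠ y → x ∉ K → y ∉ K → ({x, y} ∪ K).card = K.card + 2 := by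
    intro x y hxy hx hy
    rw [Finset.insert_union, Finset.singleton_union, Finset.card_insert_of_notMem (by simp [hxy, hx]),
      Finset.card_insert_of_notMem hy]
  have c3 : {j, l, i} ∪ K = Finset.univ := by rw [hK, Finset.union_sdiff_self_eq_union]; simp
  have jK : j ∉ K := by simp [mK]
  have lK : l ∉ K := by simp [mK]
  have iK : i ∉ K := by simp [mK]
  have rk : ∀ A : Finset V, A.card < Fintype.card V → circRank V A = A.card := fun A hA =>
    circRank_of_ne_univ (fun h => by rw [h, Finset.card_univ] at hA; exact lt_irrefl _ hA)
  have rK := rk K (by omega)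
  refine h.exists_eq_log (i := i) (j := j) (l := l) (K := K) ?_ ?_ ?_ ?_ ?_ ?_ ?_ ?_ hj ?_
  · rw [rk _ (by rw [Finset.card_singleton]; omega), Finset.card_singleton, Nat.cast_one]
  · rw [rK, rk _ (by rw [c1 _ jK]; omega), c1 _ jK]; push_cast; rfl
  · rw [rK, rk _ (by rw [c1 _ lK]; omega), c1 _ lK]; push_cast; rfl
  · rw [rK, rk _ (by rw [c1 _ iK]; omega), c1 _ iK]; push_cast; rfl
  · rw [rK, rk _ (by rw [c2 _ _ hjl jK lK]; omega), c2 _ _ hjl jK lK]; push_cast; rfl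
  · rw [rK, rk _ (by rw [c2 _ _ hij.symm jK iK]; omega), c2 _ _ hij.symm jK iK]; push_cast; rfl
  · rw [rK, rk _ (by rw [c2 _ _ hil.symm lK iK]; omega), c2 _ _ hil.symm lK iK]; push_cast; rfl
  · rw [c3, circRank_univ, rK, ← hc]; push_cast; rfl
  · refine hl.imp_right ?_
    rintro ⟨x, hx, h1, h2⟩
    exact ⟨x, (mK x).2 ⟨fun h => hj (h ▸ hx), h2, h1⟩, hx⟩

/-- Unless the circuit has three elements, exactly two of them in `T`, only logarithms of integers
occur as first coordinates. -/
lemma EntropicAt.exists_eq_log_of_card {T : Finset V} {a b : ℝ}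
    (h : EntropicAt (circRank V) (meet T) a b) (hV : 3 ≤ Fintype.card V) {j : V} (hj : j ∉ T)
    (hT : ¬ (Fintype.card V = 3 ∧ T.card = 2)) : ∃ m : ℕ, 1 ≤ m ∧ a = Real.log m := by
  by_cases hl : ∃ l, l ≠ j ∧ l ∉ T
  · obtain ⟨l, hlj, hl⟩ := hl
    obtain ⟨i, hi⟩ : ∃ i, i ∉ ({j, l} : Finset V) := by
      by_contra! hall
      have := Finset.card_le_card (fun x _ => hall x : Finset.univ ⊆ ({j, l} : Finset V))
      have h2 := Finset.card_le_two (a := j) (b := l)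
      rw [Finset.card_univ] at this
      omega
    simp only [Finset.mem_insert, Finset.mem_singleton, not_or] at hi
    exact h.exists_eq_log_of_circRank hi.1 hi.2 hlj.symm hj (Or.inl hl)
  · push Not at hl
    have hTe : T = Finset.univ.erase j := by
      ext x
      simp only [Finset.mem_erase, Finset.mem_univ, and_true]
      exact ⟨fun hx h => hj (h ▸ hx), hl x⟩
    have hc : T.card = Fintype.card V - 1 := by
      rw [hTe, Finset.card_erase_of_mem (Finset.mem_univ j), Finset.card_univ]
    -- Only `j` lies outside `T`, so outside the exceptional case `T` has three elements, and `x` is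
    -- the one that remains in `K`.
    obtain ⟨i, l, x, hi, hl', hx, hil, hix, hlx⟩ :=
      Finset.two_lt_card_iff.1 (show 2 < T.card by omega)
    exact h.exists_eq_log_of_circRank (by rintro rfl; exact hj hi) hil (by rintro rfl; exact hj hl') hj
      (Or.inr ⟨x, hx, hix.symm, hlx.symm⟩)

lemma log_ne_of_pos_of_lt_log_two {a : ℝ} (h0 : 0 < a) (h2 : a < Real.log 2) {m : ℕ}
    (hm : 1 ≤ m) : a ≠ Real.log m := by
  rintro rfl
  rcases hm.eq_or_lt with rfl | hm
  · simp at h0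
  · refine h2.not_ge (Real.log_le_log two_pos ?_)
    exact_mod_cast hm

/-- The faces spanned by a circuit with at least three elements and a rank-one matroid separating
its elements are not all-entropic. -/
lemma not_isAllEntropic_circRank (hV : 3 ≤ Fintype.card V) {T : Finset V} {j : V} (hj : j ∉ T) :
    ¬ IsAllEntropic (circRank V) (meet T) := by
  intro hall
  have h2 : 0 < Real.log 2 := Real.log_pos one_lt_two
  -- Here `a` is not the logarithm of an integer, and `a + b < log 2`, so the point is excluded in
  -- the generic and the exceptional case alike.
  have h := hall (Real.log 2 / 3) (Real.log 2 / 3) (by linarith) (by linarith)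
  by_cases hT : Fintype.card V = 3 ∧ T.card = 2
  · obtain ⟨hc, hT⟩ := hT
    obtain ⟨i, l, hil, rfl⟩ := Finset.card_eq_two.1 hT
    simp only [Finset.mem_insert, Finset.mem_singleton, not_or] at hj
    have ev : ∀ A, ((Real.log 2 / 3) • circRank V + (Real.log 2 / 3) • meet {i, l}) A =
        Real.log 2 / 3 * (circRank V A + meet {i, l} A) := fun A => by
      simp; ring
    have r1 : ∀ x, circRank V {x} = 1 := fun x => by simp [circRank, hc]
    have r2 : ∀ x y, x ≠ y → circRank V {x, y} = 2 := fun x y hxy => by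
      simp [circRank, hc, Finset.card_pair hxy]
    have r3 : circRank V {j, i, l} = 2 := by
      simp [circRank, hc, Finset.card_eq_three.2 ⟨j, i, l, hj.1, hj.2, hil, rfl⟩]
    have qj : meet {i, l} {j} = 0 := meet_of_disjoint (by simpa using hj)
    have qi : ∀ A : Finset V, i ∈ A → meet {i, l} A = 1 := fun A hA => meet_of_mem hA (by simp)
    have ql : ∀ A : Finset V, l ∈ A → meet {i, l} A = 1 := fun A hA => meet_of_mem hA (by simp)
    have := eq_zero_or_log_two_le_of_mem_entropyRegion (i := i) (j := j) (l := l) h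
      (by rw [ev, ev, ev, r1, r1, r2 _ _ hj.1, qj, qi _ (by simp), qi _ (by simp)]; ring)
      (by rw [ev, ev, ev, r1, r1, r2 _ _ hj.2, qj, ql _ (by simp), ql _ (by simp)]; ring)
      (by rw [ev, ev, r2 _ _ hj.1, r3, qi _ (by simp), qi _ (by simp)])
      (by rw [ev, ev, r2 _ _ hj.2, r3, ql _ (by simp), ql _ (by simp)])
      (by rw [ev, ev, r2 _ _ hil, r3, ql _ (by simp), ql _ (by simp)])
    rw [ev, ev, r1, r1, qj, ql _ (by simp)] at this
    rcases this with h | h <;> linarith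
  · obtain ⟨m, hm, he⟩ := h.exists_eq_log_of_card hV hj hT
    exact log_ne_of_pos_of_lt_log_two (by linarith) (by linarith) hm he

lemma ceil_exp_of_pos_of_lt_log_two {a : ℝ} (h0 : 0 < a) (h2 : a < Real.log 2) :
    ⌈Real.exp a⌉₊ = 2 := by
  rw [Nat.ceil_eq_iff two_ne_zero]
  refine ⟨by simpa using h0, ?_⟩
  exact_mod_cast (Real.le_log_iff_exp_le two_pos).1 h2.le

/-- The Matúš-type faces of circuits have three elements, exactly two of them in `T`. -/
lemma IsMatusType.card_eq [Nonempty V] {T : Finset V} (h : IsMatusType (circRank V) (meet T)) :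
    Fintype.card V = 3 ∧ T.card = 2 := by
  obtain ⟨h1, h2⟩ := h
  have l2 : 0 < Real.log 2 := Real.log_pos one_lt_two
  -- For `0 < a < log 2` the ceiling is 2, so a Matúš-type face has no entropic point with `a > 0`
  -- below the line `a + b = log 2`.
  have bad : ∀ a b : ℝ, 0 < a → 0 ≤ b → a + b < Real.log 2 →
      ¬ EntropicAt (circRank V) (meet T) a b := fun a b ha hb hab =>
    h2 a b ha.le hb (by
      rw [ceil_exp_of_pos_of_lt_log_two ha (by linarith)]
      exact_mod_cast hab)
  have hV : 3 ≤ Fintype.card V := by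
    by_contra! hlt
    -- Circuits with at most two elements have rank at most one, and then the whole ray is entropic,
    -- contradicting `bad`.
    obtain ⟨R, hR⟩ : ∃ R : Finset V, circRank V = meet R := by
      have hpos : 0 < Fintype.card V := Fintype.card_pos
      obtain hc | hc : Fintype.card V = 1 ∨ Fintype.card V = 2 := by omega
      · exact ⟨∅, funext fun A => by simp [circRank, meet, hc]⟩
      · refine ⟨Finset.univ, funext fun A => ?_⟩
        rw [circRank, meet, hc, Finset.inter_univ]
        split_ifs with hA
        · have := Finset.card_pos.2 hA
          rw [min_eq_right (by omega)]; simp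
        · simp [Finset.not_nonempty_iff_eq_empty.1 hA]
    refine bad (Real.log 2 / 2) 0 (by linarith) le_rfl (by linarith) ?_
    rw [EntropicAt, hR, zero_smul, add_zero]
    exact smul_meet_mem_entropyRegion R (by linarith)
  obtain ⟨j, hj⟩ : ∃ j, j ∉ T := by
    by_contra! hT
    have hT' : T = Finset.univ := Finset.eq_univ_iff_forall.2 hT
    -- If `T` is everything, mixing the parity code with a constant gives the entropic point `(q log
    -- 2, H(q))`, whose coordinate sum tends to 0 with `q`.
    have cont : Continuous fun q : ℝ => q * Real.log 2 + Real.binEntropy q := by fun_prop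
    have lim := cont.tendsto 0
    simp only [zero_mul, Real.binEntropy_zero, add_zero] at lim
    have ev := (lim.eventually (gt_mem_nhds l2)).filter_mono (nhdsWithin_le_nhds (s := Set.Ioi 0))
    have ev' : ∀ᶠ q in nhdsWithin (0 : ℝ) (Set.Ioi 0), q ∈ Set.Ioo (0 : ℝ) 1 :=
      Ioo_mem_nhdsGT one_pos
    obtain ⟨q, hq, hq0, hq1⟩ := (ev.and ev').exists
    refine bad (q * Real.log 2) (Real.binEntropy q) (by positivity)
      (Real.binEntropy_nonneg hq0.le hq1.le) hq ?_
    have := mixture_mem_entropyRegion log_two_smul_circRank_mem_entropyRegion (N := T)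
      (fun A => by rw [hT', Finset.inter_univ]) hq0 hq1.le
    rwa [smul_smul] at this
  by_contra hT
  -- The positive half for `v = 2` supplies an entropic point with `0 < a < log 2`, which the
  -- uniformity argument forbids.
  have hent := h1 2 ⟨le_rfl, by exact_mod_cast log_two_smul_circRank_mem_entropyRegion⟩
    (Real.log 2 / 2) (Real.log 2) (by linarith) l2.le (by push_cast; linarith)
    (by norm_num; linarith) (by push_cast; linarith)
  obtain ⟨m, hm, he⟩ := hent.exists_eq_log_of_card hV hj hT
  exact log_ne_of_pos_of_lt_log_two (by linarith) (by linarith) hm he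

end CircuitFaces

/-! ### Circuits, parallel elements, and connectivity of extreme rays. -/

section Matroids

variable {V : Type} {M : Matroid V}

/-- Replacing an element of a circuit by a parallel one. -/
lemma Matroid.IsCircuit.insert_sdiff_of_closure_eq {C : Set V} {e f : V} (hC : M.IsCircuit C)
    (heC : e ∈ C) (hfC : f ∉ C) (hf : f ∈ M.E) (hef : M.closure {e} = M.closure {f}) :
    M.IsCircuit (insert f (C \ {e})) := by
  have heE : e ∈ M.E := hC.subset_ground heC
  have hcl : e ∈ M.closure (C \ {e}) := hC.mem_closure_sdiff_singleton_of_mem heC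
  have hfcl : f ∈ M.closure (C \ {e}) := by
    have h1 : M.closure {e} ⊆ M.closure (C \ {e}) :=
      M.closure_subset_closure_of_subset_closure (by simpa using hcl)
    exact h1 (hef ▸ M.mem_closure_of_mem rfl (by simpa using hf))
  have hfI : f ∉ C \ {e} := fun h => hfC h.1
  obtain ⟨D, hD, hDc, hfD⟩ := M.exists_isCircuit_of_mem_closure hfcl hfI
  have hDf : D \ {f} ⊆ C \ {e} := by
    intro x hx
    exact (hD hx.1).resolve_left hx.2
  have hecl : e ∈ M.closure (D \ {f}) := by
    have h1 : M.closure {f} ⊆ M.closure (D \ {f}) :=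
      M.closure_subset_closure_of_subset_closure
        (by simpa using hDc.mem_closure_sdiff_singleton_of_mem hfD)
    exact h1 (hef ▸ M.mem_closure_of_mem rfl (by simpa using heE))
  -- Exchanging back from `D` yields a circuit inside `C`, hence `C` itself, so `D` has lost no
  -- element of `C \ {e}`.
  obtain ⟨D', hD', hDc', -⟩ := M.exists_isCircuit_of_mem_closure hecl fun h => (hDf h).2 rfl
  have hD'C : D' = C := Eq.symm <| hC.eq_of_superset_isCircuit hDc' fun x hx => by
    rcases hD' hx with rfl | hx
    exacts [heC, (hDf hx).1]
  have : insert f (C \ {e}) = D := by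
    refine Set.Subset.antisymm (Set.insert_subset hfD fun x hx => ?_) hD
    rw [← hD'C] at hx
    exact ((hD' hx.1).resolve_left hx.2).1
  rwa [this]

lemma Matroid.IsCircuit.closure_eq_of_pair {C : Set V} {x y : V} (hC : M.IsCircuit C)
    (hxy : x ≠ y) (h : C = {x, y}) : M.closure {x} = M.closure {y} := by
  subst h
  have hx : M.IsNonloop x := hC.isNonloop_of_mem ⟨x, by simp, y, by simp, hxy⟩ (by simp)
  exact (hx.closure_eq_closure_iff_isCircuit_of_ne hxy).2 hC

lemma cast_matroidRank (A : Finset V) : ((M.eRk (A : Set V)).toNat : ℕ∞) = M.eRk A := by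
  refine ENat.natCast_toNat fun h => ?_
  have := M.eRk_le_encard (A : Set V)
  rw [h, Set.encard_coe_eq_coe_finsetCard] at this
  simp at this

lemma matroidRank_eq {A : Finset V} {k : ℕ} (h : M.eRk (A : Set V) = k) : matroidRank M A = k := by
  rw [matroidRank, h, ENat.toNat_natCast]

lemma matroidRank_congr {A B : Finset V} (h : M.eRk (A : Set V) = M.eRk B) :
    matroidRank M A = matroidRank M B := by
  rw [matroidRank, matroidRank, h]

lemma matroidRank_nonloop {e : V} (he : M.IsNonloop e) : matroidRank M {e} = 1 := by
  rw [matroidRank_eq (k := 1) (by simpa using he.eRk_eq), Nat.cast_one]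

lemma matroidRank_loop {e : V} (he : M.IsLoop e) : matroidRank M {e} = 0 := by
  rw [matroidRank_eq (k := 0) (by simpa using he.eRk_eq), Nat.cast_zero]

lemma matroidRank_mem_polymatroidCone [DecidableEq V] (M : Matroid V) : matroidRank M ∈ polymatroidCone V := by
  refine ⟨by simp [matroidRank], fun A => Nat.cast_nonneg _, fun A B hAB => ?_, fun A B => ?_⟩
  · have h := M.eRk_mono (Finset.coe_subset.2 hAB)
    rw [← cast_matroidRank, ← cast_matroidRank (A := B), Nat.cast_le] at h
    simp only [matroidRank]
    exact_mod_cast h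
  · have h := M.eRk_inter_add_eRk_union_le A B
    rw [← Finset.coe_inter, ← Finset.coe_union, ← cast_matroidRank, ← cast_matroidRank (A := A),
      ← cast_matroidRank (A := B), ← cast_matroidRank (A := A ∪ B)] at h
    simp only [matroidRank]
    exact_mod_cast h

lemma matroidRank_of_subset_isCircuit {C A : Finset V} (hC : M.IsCircuit (C : Set V))
    (hA : A ⊆ C) : matroidRank M A = (min A.card (C.card - 1) : ℕ) := by
  refine matroidRank_eq ?_
  rcases eq_or_ne A C with rfl | hne
  · have h := hC.eRk_add_one_eq
    rw [Set.encard_coe_eq_coe_finsetCard, ← cast_matroidRank] at h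
    rw [← cast_matroidRank]
    norm_cast at h ⊢
    omega
  · have hss : A ⊂ C := hA.ssubset_of_ne hne
    rw [(hC.ssubset_indep (Finset.coe_ssubset.2 hss)).eRk_eq_encard,
      Set.encard_coe_eq_coe_finsetCard, min_eq_left]
    have := Finset.card_lt_card hss
    omega

lemma restrictTo_matroidRank {C : Finset V} (hC : M.IsCircuit (C : Set V)) :
    restrictTo (matroidRank M) C = circRank C := by
  funext A
  rw [restrictTo, matroidRank_of_subset_isCircuit hC, Finset.card_map, circRank, Fintype.card_coe]
  intro x hx
  obtain ⟨y, -, rfl⟩ := Finset.mem_map.1 hx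
  exact y.2

lemma restrictTo_meet [DecidableEq V] (N C : Finset V) : restrictTo (meet N) C = meet (N.subtype (· ∈ C)) := by
  funext A
  rw [restrictTo, meet, meet]
  refine if_congr ⟨?_, ?_⟩ rfl rfl
  · rintro ⟨x, hx⟩
    obtain ⟨h1, h2⟩ := Finset.mem_inter.1 hx
    obtain ⟨y, hy, rfl⟩ := Finset.mem_map.1 h1
    exact ⟨y, Finset.mem_inter.2 ⟨hy, Finset.mem_subtype.2 h2⟩⟩
  · rintro ⟨y, hy⟩
    obtain ⟨h1, h2⟩ := Finset.mem_inter.1 hy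
    exact ⟨y, Finset.mem_inter.2 ⟨Finset.mem_map.2 ⟨y, h1, rfl⟩, Finset.mem_subtype.1 h2⟩⟩

lemma matroidRank_inter [DecidableEq V] (hE : M.E = Set.univ) {S : Finset V} (hS : ∀ e, M.IsNonloop e → e ∈ S)
    (A : Finset V) : matroidRank M A = matroidRank M (A ∩ S) := by
  refine matroidRank_congr (le_antisymm ?_ (M.eRk_mono (by simp)))
  have h := M.eRk_le_eRk_inter_add_eRk_sdiff (A : Set V) S
  have h0 : M.eRk ((A : Set V) \ S) = 0 := by
    rw [M.eRk_eq_zero_iff (by simp [hE])]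
    intro e he
    by_contra hl
    exact he.2 (hS e (M.isNonloop_of_not_isLoop (by simp [hE]) hl))
  rwa [h0, add_zero, ← Finset.coe_inter] at h

lemma matroidRank_insert_loop [DecidableEq V] {e : V} (he : M.IsLoop e) (A : Finset V) :
    matroidRank M (insert e A) = matroidRank M A := by
  refine matroidRank_congr ?_
  rw [Finset.coe_insert, ← Set.union_singleton]
  exact M.eRk_eq_eRk_union_eRk_le_zero _ he.eRk_eq.le

lemma matroidRank_eq_meet [Fintype V] [DecidableEq V] (hE : M.E = Set.univ) (h1 : M.eRank = 1) :
    ∃ N : Finset V, matroidRank M = meet N := by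
  classical
  refine ⟨Finset.univ.filter M.IsNonloop, funext fun A => ?_⟩
  rw [matroidRank_inter hE (S := Finset.univ.filter M.IsNonloop) (by simp), meet]
  split_ifs with h
  · obtain ⟨x, hx⟩ := h
    have hx' : M.IsNonloop x := (Finset.mem_filter.1 (Finset.mem_inter.1 hx).2).2
    rw [matroidRank_eq (k := 1), Nat.cast_one]
    refine le_antisymm ((M.eRk_le_eRank _).trans h1.le) ?_
    rw [Nat.cast_one, ← hx'.eRk_eq]
    exact M.eRk_mono (by simpa using Finset.mem_inter.1 hx)
  · rw [Finset.not_nonempty_iff_eq_empty.1 h]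
    simp [matroidRank]

/-- The union of bases of the two parts is independent: a circuit in it would lie inside one of the
bases. -/
lemma eRk_eq_add_of_forall_isCircuit {S : Set V}
    (h : ∀ C, M.IsCircuit C → C ⊆ S ∨ Disjoint C S) (A : Set V) :
    M.eRk A = M.eRk (A ∩ S) + M.eRk (A \ S) := by
  refine le_antisymm (M.eRk_le_eRk_inter_add_eRk_sdiff A S) ?_
  obtain ⟨I, hI⟩ := M.exists_isBasis' (A ∩ S)
  obtain ⟨J, hJ⟩ := M.exists_isBasis' (A \ S)
  have hd : Disjoint I J :=
    Set.disjoint_left.2 fun x hx hy => (hJ.subset hy).2 (hI.subset hx).2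
  have hind : M.Indep (I ∪ J) := by
    rw [Matroid.indep_iff_forall_subset_not_isCircuit
      (Set.union_subset hI.indep.subset_ground hJ.indep.subset_ground)]
    intro C hCs hC
    rcases h C hC with hS | hS
    · refine hC.not_indep (hI.indep.subset fun x hx => (hCs hx).resolve_right fun hx' => ?_)
      exact (hJ.subset hx').2 (hS hx)
    · refine hC.not_indep (hJ.indep.subset fun x hx => (hCs hx).resolve_left fun hx' => ?_)
      exact Set.disjoint_left.1 hS hx (hI.subset hx').2
  rw [← hI.encard_eq_eRk, ← hJ.encard_eq_eRk, ← Set.encard_union_eq hd]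
  exact hind.encard_le_eRk_of_subset
    (Set.union_subset (hI.subset.trans Set.inter_subset_left) (hJ.subset.trans Set.sdiff_subset))

/-- A matroid on an extreme ray is connected up to loops. -/
lemma OnExtremeRay.exists_isCircuit [Fintype V] [DecidableEq V] (hM : OnExtremeRay (matroidRank M)) {S : Set V} {s t : V}
    (hs : M.IsNonloop s) (ht : M.IsNonloop t) (hsS : s ∈ S) (htS : t ∉ S) :
    ∃ C, M.IsCircuit C ∧ (∃ x ∈ C, x ∈ S) ∧ ∃ x ∈ C, x ∉ S := by
  classical
  by_contra! hno
  have hsep : ∀ C, M.IsCircuit C → C ⊆ S ∨ Disjoint C S := by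
    intro C hC
    by_cases hx : ∃ x ∈ C, x ∈ S
    · exact Or.inl fun y hy => hno C hC hx y hy
    · push Not at hx
      exact Or.inr (Set.disjoint_left.2 hx)
  let T : Finset V := Finset.univ.filter (· ∈ S)
  obtain ⟨r0, r1, r2, r3⟩ := matroidRank_mem_polymatroidCone M
  have hf : (fun A => matroidRank M (A ∩ T)) ∈ polymatroidCone V := by
    refine ⟨by simp [r0], fun A => r1 _, fun A B hAB => r2 _ _ (Finset.inter_subset_inter_right hAB),
      fun A B => ?_⟩
    simpa only [Finset.inter_inter_distrib_right A B T, Finset.union_inter_distrib_right A B T]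
      using r3 (A ∩ T) (B ∩ T)
  have hg : (fun A => matroidRank M (A \ T)) ∈ polymatroidCone V := by
    refine ⟨by simp [r0], fun A => r1 _, fun A B hAB => r2 _ _ (Finset.sdiff_subset_sdiff hAB le_rfl),
      fun A B => ?_⟩
    have e1 : (A ∩ B) \ T = (A \ T) ∩ (B \ T) := by ext; simp; tauto
    have e2 : (A ∪ B) \ T = (A \ T) ∪ (B \ T) := by ext; simp; tauto
    simpa only [e1, e2] using r3 (A \ T) (B \ T)
  have hsum : (fun A => matroidRank M (A ∩ T)) + (fun A => matroidRank M (A \ T)) =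
      matroidRank M := by
    funext A
    have h := eRk_eq_add_of_forall_isCircuit hsep (A : Set V)
    have e1 : (A : Set V) ∩ S = ((A ∩ T : Finset V) : Set V) := by ext; simp [T]
    have e2 : (A : Set V) \ S = ((A \ T : Finset V) : Set V) := by ext; simp [T]
    rw [e1, e2, ← cast_matroidRank, ← cast_matroidRank (A := A ∩ T),
      ← cast_matroidRank (A := A \ T)] at h
    simp only [Pi.add_apply, matroidRank]
    exact_mod_cast h.symm
  -- Extremality makes the part on `S` a multiple `c` of the rank function, but `s` forces `c = 1`
  -- and `t` forces `c = 0`.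
  obtain ⟨c, -, hc⟩ := mem_of_add_mem_of_isExposed hM.2 hf hg
    (by rw [hsum]; exact ⟨1, zero_le_one, (one_smul ℝ _).symm⟩)
  have e1 := congrFun hc {s}
  have e2 := congrFun hc {t}
  have i1 : {s} ∩ T = {s} := Finset.singleton_inter_of_mem (by simpa [T] using hsS)
  have i2 : {t} ∩ T = ∅ := Finset.singleton_inter_of_notMem (by simpa [T] using htS)
  simp only [Pi.smul_apply, smul_eq_mul, i1, i2, matroidRank_nonloop hs, matroidRank_nonloop ht,
    r0] at e1 e2
  linarith

lemma three_le_card_of_ne_pair [DecidableEq V] {C : Finset V} {x y : V} (hx : x ∈ C) (hy : y ∈ C) (hxy : x ≠ y)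
    (h : (C : Set V) ≠ {x, y}) : 3 ≤ C.card := by
  by_contra! hlt
  refine h ?_
  rw [← Finset.coe_pair, Finset.coe_inj]
  refine (Finset.eq_of_subset_of_card_le (by simp [Finset.insert_subset_iff, hx, hy]) ?_).symm
  rw [Finset.card_pair hxy]
  omega

/-- In a matroid of rank other than one on an extreme ray, some circuit with at least three
elements meets two given complementary sets containing nonloops. -/
lemma OnExtremeRay.exists_isCircuit_three_le_card [Fintype V] [DecidableEq V] (hM : OnExtremeRay (matroidRank M))
    (hE : M.E = Set.univ) (h1 : M.eRank ≠ 1) {N : Set V} {s t : V}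
    (hs : M.IsNonloop s) (ht : M.IsNonloop t) (hsN : s ∈ N) (htN : t ∉ N) :
    ∃ C : Finset V, M.IsCircuit (C : Set V) ∧ 3 ≤ C.card ∧ (∃ x ∈ C, x ∈ N) ∧ ∃ x ∈ C, x ∉ N := by
  classical
  obtain ⟨C, hC, ⟨x, hx, hxN⟩, y, hy, hyN⟩ := hM.exists_isCircuit hs ht hsN htN
  lift C to Finset V using C.toFinite
  have hxy : x ≠ y := fun h => hyN (h ▸ hxN)
  by_cases hp : (C : Set V) = {x, y}
  swap
  · exact ⟨C, hC, three_le_card_of_ne_pair hx hy hxy hp, ⟨x, hx, hxN⟩, y, hy, hyN⟩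
  have hcl := hC.closure_eq_of_pair hxy hp
  have hnx : M.IsNonloop x := hC.isNonloop_of_mem ⟨x, hx, y, hy, hxy⟩ hx
  -- The circuit found is a parallel pair split by `N`. As the rank is not one, some nonloop lies
  -- outside its parallel class, and connectivity gives a circuit `D` leaving that class at some
  -- `u`.
  obtain ⟨w, hw, hwx⟩ : ∃ w, M.IsNonloop w ∧ M.closure {w} ≠ M.closure {x} := by
    by_contra! hall
    refine h1 ?_
    have hsp : M.E ⊆ M.closure {x} := by
      intro e he
      rcases M.isLoop_or_isNonloop e he with hl | hl
      · exact hl.mem_closure _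
      · rw [← hall e hl]
        exact M.mem_closure_of_mem rfl (by simp [hE])
    rw [← M.eRk_eq_eRank hsp, M.eRk_closure_eq, hnx.eRk_eq]
  obtain ⟨D, hD, ⟨v, hv, hvx⟩, u, hu, hux⟩ := hM.exists_isCircuit
    (S := {z | M.closure {z} = M.closure {x}}) hnx hw rfl hwx
  -- The class has members on both sides of `N`. The one opposite to `u` is exchanged into `D`. It
  -- is not parallel to `u`, so the new circuit is not a pair.
  obtain ⟨z, hz, hzu⟩ : ∃ z, M.closure {z} = M.closure {x} ∧ (z ∈ N ↔ u ∉ N) := by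
    by_cases huN : u ∈ N
    · exact ⟨y, hcl.symm, by simp [hyN, huN]⟩
    · exact ⟨x, rfl, by simp [hxN, huN]⟩
  have hzu' : z ≠ u := fun h => hux (by rw [← h]; exact hz)
  obtain ⟨D', hD', hzD, huD⟩ : ∃ D', M.IsCircuit D' ∧ z ∈ D' ∧ u ∈ D' := by
    by_cases hzD : z ∈ D
    · exact ⟨D, hD, hzD, hu⟩
    · refine ⟨_, hD.insert_sdiff_of_closure_eq hv hzD (by simp [hE]) (hvx.trans hz.symm),
        Set.mem_insert _ _, Or.inr ⟨hu, fun h => hux ?_⟩⟩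
      rw [Set.mem_singleton_iff.1 h]
      exact hvx
  lift D' to Finset V using D'.toFinite
  refine ⟨D', hD', three_le_card_of_ne_pair hzD huD hzu' fun h => hux ?_, ?_⟩
  · exact (hD'.closure_eq_of_pair hzu' h).symm.trans hz
  · by_cases huN : u ∈ N
    · exact ⟨⟨u, huD, huN⟩, z, hzD, fun h => hzu.1 h huN⟩
    · exact ⟨⟨z, hzD, hzu.2 huN⟩, u, huD, huN⟩

end Matroids

/-! ### Why a unique Matúš-type circuit contains all nonloops. -/

section MatusFaces

variable {V : Type} [DecidableEq V] {M : Matroid V} {N : Finset V}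

/-- In a rank-two matroid with three parallel classes `{x}`, `{y}` and the class of `j`, if `N`
contains all the nonloops but `j`, and a parallel `z` of `j` among them, then the pair is not a
two-dimensional face. -/
lemma not_isTwoDimFace_of_parallel (hE : M.E = Set.univ) {j x y z : V}
    (hC : M.IsCircuit ({j, x, y} : Finset V)) (hjx : j ≠ x) (hjy : j ≠ y) (hxy : x ≠ y)
    (hjN : j ∉ N) (hxN : x ∈ N) (hyN : y ∈ N) (hzN : z ∈ N) (hz : z ≠ x ∧ z ≠ y)
    (hN : ∀ e ∈ N, e ≠ x → e ≠ y → M.closure {e} = M.closure {j})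
    (hnl : ∀ e, M.IsNonloop e → e = j ∨ e ∈ N) :
    ¬ IsTwoDimFace (matroidRank M) (meet N) := by
  intro hF
  have hnt : (({j, x, y} : Finset V) : Set V).Nontrivial := ⟨j, by simp, x, by simp, hjx⟩
  have nj : M.IsNonloop j := hC.isNonloop_of_mem hnt (by simp)
  have nx : M.IsNonloop x := hC.isNonloop_of_mem hnt (by simp)
  set X : Finset V := (N.erase x).erase y with hX
  have mX : ∀ e, e ∈ X ↔ e ∈ N ∧ e ≠ x ∧ e ≠ y := by intro e; simp [hX]; tauto
  have clX : ∀ e ∈ X, M.closure {e} = M.closure {j} := fun e he =>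
    hN e ((mX e).1 he).1 ((mX e).1 he).2.1 ((mX e).1 he).2.2
  have hzX : z ∈ X := (mX z).2 ⟨hzN, hz⟩
  have hjX : j ∉ X := fun h => hjN ((mX j).1 h).1
  -- the rank depends only on which parallel classes are met
  set B : Finset V → Finset V := fun A =>
    ({j, x, y} : Finset V).filter fun c => c ∈ A ∨ c = j ∧ (A ∩ X).Nonempty with hB
  have rB : ∀ A, matroidRank M A = matroidRank M (B A) := by
    intro A
    refine matroidRank_congr ?_
    refine le_antisymm ?_ ?_
    · rw [← M.eRk_closure_eq (B A : Set V)]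
      refine M.eRk_mono fun e he => ?_
      by_cases hl : M.IsLoop e
      · exact hl.mem_closure _
      have hmem : ∀ c ∈ B A, c ∈ M.closure (B A : Set V) := fun c hc =>
        M.mem_closure_of_mem (by simpa using hc) (by simp [hE])
      by_cases hex : e ∈ X
      · have hj : j ∈ B A := by
          simp only [hB, Finset.mem_filter, Finset.mem_insert, true_or, true_and]
          exact Or.inr ⟨e, Finset.mem_inter.2 ⟨he, hex⟩⟩
        have : e ∈ M.closure {j} := by
          rw [← clX e hex]; exact M.mem_closure_of_mem rfl (by simp [hE])
        exact M.closure_subset_closure (by simpa using hj) this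
      · refine hmem e ?_
        simp only [hB, Finset.mem_filter, Finset.mem_insert, Finset.mem_singleton]
        refine ⟨?_, Or.inl he⟩
        have h1 := hnl e (M.isNonloop_of_not_isLoop (by simp [hE]) hl)
        rw [mX] at hex
        tauto
    · rw [← M.eRk_closure_eq (A : Set V)]
      refine M.eRk_mono fun c hc => ?_
      simp only [hB, Finset.coe_filter, Set.mem_ofPred_eq] at hc
      rcases hc.2 with hcA | ⟨rfl, e, he⟩
      · exact M.mem_closure_of_mem (by simpa using hcA) (by simp [hE])
      · obtain ⟨heA, heX⟩ := Finset.mem_inter.1 he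
        have : c ∈ M.closure {e} := by
          rw [clX e heX]; exact M.mem_closure_of_mem rfl (by simp [hE])
        exact M.closure_subset_closure (by simpa using heA) this
  have cardC : ({j, x, y} : Finset V).card = 3 :=
    Finset.card_eq_three.2 ⟨j, x, y, hjx, hjy, hxy, rfl⟩
  -- A second decomposition of `matroidRank M + meet N`: parallels of `j` in `N` become elements of
  -- weight 2, and the rank-one part keeps only `x` and `y`.
  set w : V → ℕ := fun e => if e ∈ X then 2 else if e = j ∨ e = x ∨ e = y then 1 else 0 with hw
  have hsum : meet {x, y} + (fun A : Finset V => ((min (∑ i ∈ A, w i) 2 : ℕ) : ℝ)) =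
      (1 : ℝ) • matroidRank M + (1 : ℝ) • meet N := by
    funext A
    have cB : (B A).card = (if j ∈ A ∨ (A ∩ X).Nonempty then 1 else 0) +
        ((if x ∈ A then 1 else 0) + if y ∈ A then 1 else 0) := by
      rw [hB, Finset.card_filter, Finset.sum_insert (by simp [hjx, hjy]),
        Finset.sum_insert (by simpa using hxy), Finset.sum_singleton]
      simp [hjx.symm, hjy.symm]
    have cw : ∑ i ∈ A, w i = 2 * (A ∩ X).card + ((if j ∈ A then 1 else 0) +
        ((if x ∈ A then 1 else 0) + if y ∈ A then 1 else 0)) := by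
      have hw' : ∀ e, w e = (if e ∈ X then 2 else 0) + ((if e = j then 1 else 0) +
          ((if e = x then 1 else 0) + if e = y then 1 else 0)) := by
        intro e
        have h1 : e ∈ X → e ≠ j := fun h h' => hjX (h' ▸ h)
        have h2 := mX e
        simp only [hw]
        by_cases hX : e ∈ X
        · have := h1 hX
          have := h2.1 hX
          simp [*]
        · by_cases e1 : e = j
          · subst e1; simp [hX, hjx, hjy]
          · by_cases e2 : e = x
            · subst e2; simp [hX, hxy, hjx.symm]
            · simp [hX, e1, e2]
      simp only [hw', Finset.sum_add_distrib, Finset.sum_ite_eq', Finset.sum_ite_mem,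
        Finset.sum_const, smul_eq_mul, mul_comm]
    have hmN : meet N A = if x ∈ A ∨ y ∈ A ∨ (A ∩ X).Nonempty then 1 else 0 := by
      rw [meet]
      refine if_congr ⟨?_, ?_⟩ rfl rfl
      · rintro ⟨e, he⟩
        obtain ⟨h1, h2⟩ := Finset.mem_inter.1 he
        by_cases ex : e = x
        · exact Or.inl (ex ▸ h1)
        by_cases ey : e = y
        · exact Or.inr (Or.inl (ey ▸ h1))
        exact Or.inr (Or.inr ⟨e, Finset.mem_inter.2 ⟨h1, (mX e).2 ⟨h2, ex, ey⟩⟩⟩)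
      · rintro (h | h | ⟨e, he⟩)
        · exact ⟨x, Finset.mem_inter.2 ⟨h, hxN⟩⟩
        · exact ⟨y, Finset.mem_inter.2 ⟨h, hyN⟩⟩
        · obtain ⟨h1, h2⟩ := Finset.mem_inter.1 he
          exact ⟨e, Finset.mem_inter.2 ⟨h1, ((mX e).1 h2).1⟩⟩
    have hmxy : meet {x, y} A = if x ∈ A ∨ y ∈ A then 1 else 0 := by
      rw [meet]
      refine if_congr ⟨?_, ?_⟩ rfl rfl
      · rintro ⟨e, he⟩
        simp only [Finset.mem_inter, Finset.mem_insert, Finset.mem_singleton] at he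
        obtain ⟨h1, rfl | rfl⟩ := he
        exacts [Or.inl h1, Or.inr h1]
      · rintro (h | h)
        exacts [⟨x, by simp [h]⟩, ⟨y, by simp [h]⟩]
    have hcard : (A ∩ X).Nonempty ↔ 1 ≤ (A ∩ X).card := Finset.card_pos.symm
    simp only [Pi.add_apply, Pi.smul_apply, smul_eq_mul, one_mul, rB A]
    rw [matroidRank_of_subset_isCircuit hC (Finset.filter_subset _ _), cardC]
    change _ = ((min (B A).card _ : ℕ) : ℝ) + _
    rw [cB, cw, hmN, hmxy]
    generalize (A ∩ X).card = k at *
    have : ((if x ∈ A ∨ y ∈ A then 1 else 0) + min (2 * k + ((if j ∈ A then 1 else 0) +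
        ((if x ∈ A then 1 else 0) + if y ∈ A then 1 else 0))) 2 : ℕ) =
        min ((if j ∈ A ∨ (A ∩ X).Nonempty then 1 else 0) +
        ((if x ∈ A then 1 else 0) + if y ∈ A then 1 else 0)) (3 - 1) +
        (if x ∈ A ∨ y ∈ A ∨ (A ∩ X).Nonempty then 1 else 0) := by
      by_cases h1 : x ∈ A <;> by_cases h2 : y ∈ A <;> by_cases h3 : j ∈ A <;>
        by_cases h4 : (A ∩ X).Nonempty <;> simp only [h1, h2, h3, h4, or_true, or_false, or_self,
          if_true, if_false] <;> rw [hcard] at h4 <;> omega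
    exact_mod_cast this
  obtain ⟨a, b, -, -, hab⟩ := mem_of_add_mem_of_isExposed hF.2 (meet_mem_polymatroidCone {x, y})
    (truncation_mem_polymatroidCone w 2) ⟨1, 1, zero_le_one, zero_le_one, hsum⟩
  have nz : M.IsNonloop z := by
    refine nj.isNonloop_of_mem_closure ?_
    rw [clX z hzX]
    exact M.mem_closure_of_mem rfl (by simp [hE])
  -- If `meet {x, y}` were in the span, `j` would give `a = 0`, while `z` and `x` would give `a + b
  -- = 0` and `a + b = 1`.
  have ej := congrFun hab {j}
  have ez := congrFun hab {z}
  have ex := congrFun hab {x}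
  simp only [Pi.add_apply, Pi.smul_apply, smul_eq_mul, matroidRank_nonloop, nj, nz, nx] at ej ez ex
  rw [meet_of_disjoint (by simp [hjx, hjy]), meet_of_disjoint (by simpa using hjN)] at ej
  rw [meet_of_disjoint (by simpa using hz), meet_of_mem (x := z) (by simp) hzN] at ez
  rw [meet_of_mem (x := x) (by simp) (by simp), meet_of_mem (x := x) (by simp) hxN] at ex
  linarith

/-- If a three-element circuit with exactly two elements in `N` is the only circuit with at least
three elements meeting both `N` and its complement, then it contains all the nonloops. -/
lemma mem_of_forall_isCircuit_eq [Fintype V] (hE : M.E = Set.univ) (hM : OnExtremeRay (matroidRank M))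
    (hF : IsTwoDimFace (matroidRank M) (meet N)) {j x y : V}
    (hC : M.IsCircuit ({j, x, y} : Finset V)) (hjx : j ≠ x) (hjy : j ≠ y) (hxy : x ≠ y)
    (hjN : j ∉ N) (hxN : x ∈ N) (hyN : y ∈ N) (hloop : ∀ e, M.IsLoop e → e ∉ N)
    (huniq : ∀ D : Finset V, M.IsCircuit (D : Set V) → 3 ≤ D.card → (∃ u ∈ D, u ∈ N) →
      (∃ u ∈ D, u ∉ N) → D = {j, x, y}) {e : V} (he : M.IsNonloop e) :
    e ∈ ({j, x, y} : Finset V) := by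
  have hEm : ∀ v, v ∈ M.E := by simp [hE]
  have mC : ∀ v, v ∈ (({j, x, y} : Finset V) : Set V) ↔ v = j ∨ v = x ∨ v = y := by simp
  have hnt : (({j, x, y} : Finset V) : Set V).Nontrivial := ⟨j, by simp, x, by simp, hjx⟩
  have nj : M.IsNonloop j := hC.isNonloop_of_mem hnt (by simp)
  have nx : M.IsNonloop x := hC.isNonloop_of_mem hnt (by simp)
  -- a mixed circuit is the given one or a pair
  have mixed : ∀ D : Set V, M.IsCircuit D → ∀ u ∈ D, ∀ v ∈ D, u ∈ N → v ∉ N →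
      (∃ c ∈ D, c ∉ ({j, x, y} : Finset V)) ∨ (∃ c ∈ ({j, x, y} : Finset V), c ∉ D) →
      M.closure {u} = M.closure {v} := by
    intro D hD u hu v hv huN hvN hne
    have huv : u ≠ v := fun h => hvN (h ▸ huN)
    lift D to Finset V using D.toFinite
    by_contra hcl
    have hc := three_le_card_of_ne_pair hu hv huv fun h => hcl (hD.closure_eq_of_pair huv h)
    have hDC := huniq D hD hc ⟨u, hu, huN⟩ ⟨v, hv, hvN⟩
    subst hDC
    rcases hne with ⟨c, h1, h2⟩ | ⟨c, h1, h2⟩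
    exacts [h2 (by simpa using h1), h2 (by simpa using h1)]
  -- parallel elements inside the circuit are equal
  have inC : ∀ u v, u ∈ ({j, x, y} : Finset V) → v ∈ ({j, x, y} : Finset V) →
      M.closure {u} = M.closure {v} → u = v := by
    intro u v hu hv huv
    by_contra hne
    have nu : M.IsNonloop u := hC.isNonloop_of_mem hnt (by simpa using hu)
    have hp := (nu.closure_eq_closure_iff_isCircuit_of_ne hne).1 huv
    have := hC.eq_of_superset_isCircuit hp (by
      rw [← Finset.coe_pair, Finset.coe_subset]
      exact Finset.insert_subset hu (Finset.singleton_subset_iff.2 hv))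
    rw [← Finset.coe_pair, Finset.coe_inj] at this
    have h3 := Finset.card_le_two (a := u) (b := v)
    rw [← this, Finset.card_eq_three.2 ⟨j, x, y, hjx, hjy, hxy, rfl⟩] at h3
    omega
  -- Exchanging `c` for an outside parallel `z` gives another mixed circuit, which would make `d`
  -- parallel to `j`.
  have par_N : ∀ c d, ({j, x, y} : Finset V) = {j, c, d} → c ∈ N → d ∈ N → c ≠ d → j ≠ d → j ≠ c →
      ∀ z, z ∉ ({j, x, y} : Finset V) → M.closure {z} ≠ M.closure {c} := by
    intro c d hcd hcN hdN hne hjd hjc z hz hcl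
    have hex := hC.insert_sdiff_of_closure_eq (e := c) (by simp [hcd]) (f := z) (by simpa using hz)
      (hEm z) hcl.symm
    have h1 := mixed _ hex d (by simp [hcd, hne.symm]) j (by simp [hcd, hjc]) hdN hjN
      (Or.inl ⟨z, by simp, hz⟩)
    exact hjd (inC d j (by simp [hcd]) (by simp) h1).symm
  have par_x := par_N x y rfl hxN hyN hxy hjy hjx
  have par_y := par_N y x (by rw [Finset.pair_comm]) hyN hxN hxy.symm hjx hjy
  have par_j : ∀ z, z ∉ ({j, x, y} : Finset V) → z ∉ N → M.closure {z} ≠ M.closure {j} := by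
    intro z hz hzN hcl
    have hex := hC.insert_sdiff_of_closure_eq (e := j) (by simp) (f := z) (by simpa using hz)
      (hEm z) hcl.symm
    have h1 := mixed _ hex x (by simp [hjx.symm]) z (by simp) hxN hzN (Or.inl ⟨z, by simp, hz⟩)
    exact par_x z hz h1.symm
  -- Otherwise connectivity gives a circuit `D` leaving the set `S` of allowed elements at some `u`.
  -- By the preceding facts `u` is parallel to nothing in `S`, which forces `D` to lie entirely on
  -- one side of `N`.
  have key : ∀ w, M.IsNonloop w → w ∈ ({j, x, y} : Finset V) ∨
      w ∈ N ∧ M.closure {w} = M.closure {j} := by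
    by_contra! hw
    obtain ⟨w, nw, hwC, hwX⟩ := hw
    set S : Set V := {v | v ∈ ({j, x, y} : Finset V) ∨ v ∈ N ∧ M.closure {v} = M.closure {j}} with hS
    obtain ⟨D, hD, ⟨s, hs, hsS⟩, u, hu, huS⟩ := hM.exists_isCircuit (S := S) nj nw
      (Or.inl (by simp)) (by rintro (h | h); exacts [hwC h, hwX h.1 h.2])
    have huC : u ∉ ({j, x, y} : Finset V) := fun h => huS (Or.inl h)
    have huX : u ∈ N → M.closure {u} ≠ M.closure {j} := fun h h' => huS (Or.inr ⟨h, h'⟩)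
    have hmix : ∀ a ∈ D, ∀ b ∈ D, a ∈ N → b ∉ N → M.closure {a} = M.closure {b} :=
      fun a ha b hb haN hbN => mixed D hD a ha b hb haN hbN (Or.inl ⟨u, hu, huC⟩)
    have parS : ∀ v ∈ S, M.closure {u} ≠ M.closure {v} := by
      rintro v (hv | hv) hcl
      · simp only [Finset.mem_insert, Finset.mem_singleton] at hv
        rcases hv with rfl | rfl | rfl
        · by_cases huN : u ∈ N
          exacts [huX huN hcl, par_j u huC huN hcl]
        · exact par_x u huC hcl
        · exact par_y u huC hcl
      · rw [hv.2] at hcl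
        by_cases huN : u ∈ N
        exacts [huX huN hcl, par_j u huC huN hcl]
    by_cases huN : u ∈ N
    · have hDN : ∀ v ∈ D, v ∈ N := by
        intro v hv
        by_contra hvN
        have hsv : s = v ∨ M.closure {s} = M.closure {u} := by
          by_cases hsN : s ∈ N
          · exact Or.inr ((hmix s hs v hv hsN hvN).trans (hmix u hu v hv huN hvN).symm)
          · exact Or.inr (hmix u hu s hs huN hsN).symm
        rcases hsv with rfl | h
        · exact parS s hsS (hmix u hu s hs huN hvN)
        · exact parS s hsS h.symm
      -- With `D` inside `N`, a circuit through `j` mixing the sides is made by exchange if `D`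
      -- contains a parallel of `j`, and otherwise by eliminating `s` between the two circuits.
      by_cases hX : ∃ z ∈ D, M.closure {z} = M.closure {j}
      · obtain ⟨z, hz, hzj⟩ := hX
        have hex := hD.insert_sdiff_of_closure_eq hz (fun h => hjN (hDN j h)) (hEm j) hzj
        have huz : u ≠ z := fun h => huX huN (h ▸ hzj)
        exact huX huN (mixed _ hex u (Or.inr ⟨hu, huz⟩) j (Set.mem_insert _ _) huN hjN
          (Or.inl ⟨u, Or.inr ⟨hu, huz⟩, huC⟩))
      · push Not at hX
        have hsC : s ∈ ({j, x, y} : Finset V) := hsS.resolve_right fun h => hX s hs h.2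
        obtain ⟨C₁, hC₁s, hC₁, hjC₁⟩ := hC.strong_elimination hD (e := s) (f := j)
          (by simpa using hsC) hs (by simp) (fun h => hjN (hDN j h))
        obtain ⟨v, hv, hvj⟩ : ∃ v ∈ C₁, v ≠ j := by
          by_contra! hall
          have : C₁ = {j} := Set.eq_singleton_iff_unique_mem.2 ⟨hjC₁, hall⟩
          rw [this, Matroid.singleton_isCircuit] at hC₁
          exact hC₁.not_isNonloop nj
        have hvN : v ∈ N := by
          rcases (hC₁s hv).1 with h | h
          · rcases (mC v).1 h with rfl | rfl | rfl
            exacts [(hvj rfl).elim, hxN, hyN]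
          · exact hDN v h
        have hcl := mixed C₁ hC₁ v hv j hjC₁ hvN hjN (Or.inr ⟨s, hsC, fun h => (hC₁s h).2 rfl⟩)
        rcases (hC₁s hv).1 with h | h
        · exact hvj (inC v j (by simpa using h) (by simp) hcl)
        · exact hX v h hcl
    · have hDN : ∀ v ∈ D, v ∉ N := by
        intro v hv hvN
        have hsN : s ∉ N := fun hsN => parS s hsS (hmix s hs u hu hsN huN).symm
        exact parS s hsS ((hmix v hv u hu hvN huN).symm.trans (hmix v hv s hs hvN hsN))
      have hsj : s = j := by
        rcases hsS with h | h
        · simp only [Finset.mem_insert, Finset.mem_singleton] at h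
          rcases h with h | rfl | rfl
          exacts [h, (hDN _ hs hxN).elim, (hDN _ hs hyN).elim]
        · exact (hDN s hs h.1).elim
      subst hsj
      -- With `D` outside `N`, the common element is `j`. Eliminating it while keeping `x` leaves a
      -- mixed circuit with some `v` from `D` outside the triple, parallel to `x`, contrary to
      -- `par_x`.
      obtain ⟨C₁, hC₁s, hC₁, hxC₁⟩ := hC.strong_elimination hD (e := s) (f := x) (by simp) hs
        (by simp) (fun h => hDN x h hxN)
      obtain ⟨v, hv, hvC⟩ : ∃ v ∈ C₁, v ∉ (({s, x, y} : Finset V) : Set V) := by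
        by_contra! hall
        have := hC.eq_of_superset_isCircuit hC₁ hall
        have hs1 : s ∈ C₁ := this ▸ (mC s).2 (Or.inl rfl)
        exact (hC₁s hs1).2 rfl
      have hvD : v ∈ D := (hC₁s hv).1.resolve_left hvC
      exact par_x v (by simpa using hvC) (mixed C₁ hC₁ x hxC₁ v hv hxN (hDN v hvD)
        (Or.inl ⟨v, hv, by simpa using hvC⟩)).symm
  -- Circuits alone cannot exclude a parallel of `j` inside `N`. Here the hypothesis that the pair
  -- is a face is needed.
  refine (key e he).resolve_right fun ⟨heN, hej⟩ => ?_
  by_cases heC : e ∈ ({j, x, y} : Finset V)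
  · exact hjN (inC e j heC (by simp) hej ▸ heN)
  simp only [Finset.mem_insert, Finset.mem_singleton, not_or] at heC
  refine not_isTwoDimFace_of_parallel hE hC hjx hjy hxy hjN hxN hyN heN heC.2 ?_ ?_ hF
  · intro z hzN hzx hzy
    have hz := key z (M.isNonloop_of_not_isLoop (hEm z) fun h => hloop z h hzN)
    simp only [Finset.mem_insert, Finset.mem_singleton] at hz
    rcases hz with (h | h | h) | h
    exacts [by rw [h], (hzx h).elim, (hzy h).elim, h.2]
  · intro z hz
    have hz := key z hz
    simp only [Finset.mem_insert, Finset.mem_singleton] at hz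
    rcases hz with (h | h | h) | h
    exacts [Or.inl h, Or.inr (h ▸ hxN), Or.inr (h ▸ hyN), Or.inr h.1]

end MatusFaces

/-! ### The three types of faces. -/

section Main

variable {V : Type} [DecidableEq V] {M : Matroid V} {N : Finset V}

lemma EntropicAt.restriction [Fintype V] {P Q : Finset V → ℝ} {a b : ℝ} (h : EntropicAt P Q a b)
    (S : Finset V) : EntropicAt (restrictTo P S) (restrictTo Q S) a b :=
  restrictTo_mem_entropyRegion h S

/-- A circuit with at least three elements meeting `N` and its complement gives a restricted face
that is not all-entropic. -/
lemma isTwoDimFace_and_not_isAllEntropic {C : Finset V} (hC : M.IsCircuit (C : Set V))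
    (h3 : 3 ≤ C.card) (hN : ∃ x ∈ C, x ∈ N) (hN' : ∃ x ∈ C, x ∉ N) :
    IsTwoDimFace (restrictTo (matroidRank M) C) (restrictTo (meet N) C) ∧
      ¬ IsAllEntropic (restrictTo (matroidRank M) C) (restrictTo (meet N) C) := by
  obtain ⟨x, hx, hxN⟩ := hN
  obtain ⟨y, hy, hyN⟩ := hN'
  rw [restrictTo_matroidRank hC, restrictTo_meet]
  have hy' : (⟨y, hy⟩ : C) ∉ N.subtype (· ∈ C) := by simpa using hyN
  have hx' : (⟨x, hx⟩ : C) ∈ N.subtype (· ∈ C) := by simpa using hxN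
  rw [← Fintype.card_coe] at h3
  exact ⟨isTwoDimFace_circRank_meet h3 hy' hx', not_isAllEntropic_circRank h3 hy'⟩

/-- The Matúš-type restrictions to circuits. -/
lemma exists_of_isMatusType {C : Finset V} (hC : M.IsCircuit (C : Set V))
    (h : IsMatusType (restrictTo (matroidRank M) C) (restrictTo (meet N) C)) :
    ∃ j x y, C = {j, x, y} ∧ j ≠ x ∧ j ≠ y ∧ x ≠ y ∧ j ∉ N ∧ x ∈ N ∧ y ∈ N := by
  rw [restrictTo_matroidRank hC, restrictTo_meet] at h
  obtain ⟨c, hc⟩ := hC.nonempty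
  have : Nonempty C := ⟨⟨c, hc⟩⟩
  obtain ⟨h3, h2⟩ := h.card_eq
  rw [Fintype.card_coe] at h3
  rw [Finset.card_subtype, Finset.filter_mem_eq_inter] at h2
  have h1 : (C \ N).card = 1 := by
    have := Finset.card_inter_add_card_sdiff C N
    rw [Finset.inter_comm] at this
    omega
  obtain ⟨x, y, hxy, hNC⟩ := Finset.card_eq_two.1 h2
  obtain ⟨j, hj⟩ := Finset.card_eq_one.1 h1
  have mx := Finset.mem_inter.1 (hNC ▸ Finset.mem_insert_self x {y} : x ∈ N ∩ C)
  have my := Finset.mem_inter.1 (hNC ▸ by simp : y ∈ N ∩ C)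
  have mj := Finset.mem_sdiff.1 (hj ▸ Finset.mem_singleton_self j : j ∈ C \ N)
  refine ⟨j, x, y, ?_, fun h => mj.2 (h ▸ mx.1), fun h => mj.2 (h ▸ my.1), hxy, mj.2, mx.1, my.1⟩
  rw [Finset.insert_eq, ← hNC, ← hj, Finset.inter_comm, Finset.sdiff_union_inter]

lemma isAllEntropic_matroidRank_of_eRank_eq_one [Fintype V] (hE : M.E = Set.univ) (h1 : M.eRank = 1) :
    IsAllEntropic (matroidRank M) (meet N) := by
  obtain ⟨R, hR⟩ := matroidRank_eq_meet hE h1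
  intro a b ha hb
  rw [EntropicAt, hR]
  exact add_mem_entropyRegion (smul_meet_mem_entropyRegion R ha.le)
    (smul_meet_mem_entropyRegion N hb.le)

/-- If `P` is carried by `N` and its ray is entropic, then mixing large multiples of `P` with the
constant vector realises every point with positive coordinates. -/
lemma isAllEntropic_of_isEntropicRay [Fintype V] {P : Finset V → ℝ} (hP : IsEntropicRay P)
    (hN : ∀ A, P A = P (A ∩ N)) : IsAllEntropic P (meet N) := by
  obtain ⟨c, hc, hcP⟩ := hP
  intro a b ha hb
  have lim : Filter.Tendsto (fun k : ℕ => Real.binEntropy (a / c / k)) Filter.atTop (nhds 0) := by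
    rw [← Real.binEntropy_zero]
    exact (Real.binEntropy_continuous.tendsto 0).comp (tendsto_const_div_atTop_nhds_zero_nat _)
  have lim' := tendsto_const_div_atTop_nhds_zero_nat (a / c)
  -- The mixing weight `q = a / (c k)` makes the mixture of `k c P` contribute exactly `a P`. For
  -- large `k` its cost `H(q)` is below `b`, and a multiple of `meet N` supplies the rest.
  obtain ⟨k, hk1, hk2, hk0⟩ := ((lim.eventually (gt_mem_nhds hb)).and
    ((lim'.eventually (gt_mem_nhds one_pos)).and (Filter.eventually_gt_atTop 0))).exists
  have hk : (0 : ℝ) < k := Nat.cast_pos.2 hk0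
  have hq : 0 < a / c / k := div_pos (div_pos ha hc) hk
  have h1 := mixture_mem_entropyRegion (nsmul_mem_entropyRegion hcP k) (N := N)
    (fun A => by simp only [Pi.smul_apply, smul_eq_mul]; rw [hN]) hq hk2.le
  have h2 := add_mem_entropyRegion h1
    (smul_meet_mem_entropyRegion N (sub_nonneg.2 hk1.le))
  rw [add_assoc, ← add_smul, add_sub_cancel, smul_smul, smul_smul] at h2
  have : a / c / k * (k * c) = a := by field_simp
  rwa [mul_assoc (a / c / k), this] at h2

/-- In rank other than one, the condition on circuits serves only to force all nonloops into `N`,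
after which mixing applies. -/
lemma isAllEntropic_matroidRank [Fintype V] (hE : M.E = Set.univ) (hM : OnExtremeRay (matroidRank M))
    (hent : IsEntropicRay (matroidRank M)) (hi : ∃ i, ¬ M.IsLoop i ∧ i ∈ N)
    (hC : ∀ C : Finset V, M.IsCircuit (C : Set V) →
      IsTwoDimFace (restrictTo (matroidRank M) C) (restrictTo (meet N) C) →
      IsAllEntropic (restrictTo (matroidRank M) C) (restrictTo (meet N) C)) :
    IsAllEntropic (matroidRank M) (meet N) := by
  by_cases h1 : M.eRank = 1
  · exact isAllEntropic_matroidRank_of_eRank_eq_one hE h1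
  refine isAllEntropic_of_isEntropicRay hent (matroidRank_inter hE fun e he => ?_)
  by_contra heN
  obtain ⟨i, hi, hiN⟩ := hi
  obtain ⟨C, hCc, h3, hm, hm'⟩ := hM.exists_isCircuit_three_le_card hE h1 (N := (N : Set V))
    (M.isNonloop_of_not_isLoop (by simp [hE]) hi) he hiN heN
  obtain ⟨hf, hn⟩ := isTwoDimFace_and_not_isAllEntropic hCc h3 hm hm'
  exact hn (hC C hCc hf)

/-- Outside `C` everything is a loop of both matroids. So entropic points on `C` extend by
constants, and the characteristic set of `M` is contained in that of the circuit. -/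
lemma isMatusType_matroidRank [Fintype V] (hE : M.E = Set.univ) (hM : OnExtremeRay (matroidRank M))
    (hF : IsTwoDimFace (matroidRank M) (meet N)) {C : Finset V} (hC : M.IsCircuit (C : Set V))
    (hCt : IsMatusType (restrictTo (matroidRank M) C) (restrictTo (meet N) C))
    (hC' : ∀ C' : Finset V, M.IsCircuit (C' : Set V) → C' ≠ C →
      IsTwoDimFace (restrictTo (matroidRank M) C') (restrictTo (meet N) C') →
      IsAllEntropic (restrictTo (matroidRank M) C') (restrictTo (meet N) C'))
    (hloop : ∀ e, M.IsLoop e → e ∉ N) : IsMatusType (matroidRank M) (meet N) := by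
  have hnl : ∀ e, M.IsNonloop e → e ∈ C := by
    obtain ⟨j, x, y, rfl, hjx, hjy, hxy, hj, hx, hy⟩ := exists_of_isMatusType hC hCt
    intro e he
    refine mem_of_forall_isCircuit_eq hE hM hF hC hjx hjy hxy hj hx hy hloop ?_ he
    intro D hD h3 hm hm'
    by_contra hne
    obtain ⟨hf, hn⟩ := isTwoDimFace_and_not_isAllEntropic hD h3 hm hm'
    exact hn (hC' D hD hne hf)
  have hNC : ∀ A, meet N A = meet N (A ∩ C) := by
    intro A
    have hsub : N ⊆ C := fun e he =>
      hnl e (M.isNonloop_of_not_isLoop (by simp [hE]) fun h => hloop e h he)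
    rw [meet, meet, Finset.inter_assoc, Finset.inter_eq_right.2 hsub]
  refine ⟨fun v hv a b ha hb h1 h2 h3 => ?_, fun a b ha hb hab h => ?_⟩
  · refine mem_entropyRegion_of_restrictTo (S := C) (fun A => ?_)
      (hCt.1 v ⟨hv.1, restrictTo_mem_entropyRegion hv.2 C⟩ a b ha hb h1 h2 h3)
    simp only [Pi.add_apply, Pi.smul_apply]
    rw [hNC, matroidRank_inter hE hnl]
  · exact hCt.2 a b ha hb hab (h.restriction C)

/-- A loop of `M` in `N` turns a Matúš-type circuit into an obstruction of Chen–Yeung type. -/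
lemma EntropicAt.exists_eq_log_of_isLoop [Fintype V] {C : Finset V} (hC : M.IsCircuit (C : Set V))
    (hCt : IsMatusType (restrictTo (matroidRank M) C) (restrictTo (meet N) C)) {e : V}
    (he : M.IsLoop e) (heN : e ∈ N) {a b : ℝ} (h : EntropicAt (matroidRank M) (meet N) a b) :
    ∃ m : ℕ, 1 ≤ m ∧ a = Real.log m := by
  obtain ⟨j, x, y, rfl, hjx, hjy, hxy, hj, -, -⟩ := exists_of_isMatusType hC hCt
  have h3 : ({j, x, y} : Finset V).card = 3 :=
    Finset.card_eq_three.2 ⟨j, x, y, hjx, hjy, hxy, rfl⟩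
  have r : ∀ A : Finset V, A ⊆ {j, x, y} → matroidRank M (A ∪ {e}) = (min A.card 2 : ℕ) := by
    intro A hA
    rw [Finset.union_singleton, matroidRank_insert_loop he, matroidRank_of_subset_isCircuit hC hA,
      h3]
  have re := matroidRank_loop he
  have hnt : (({j, x, y} : Finset V) : Set V).Nontrivial := ⟨j, by simp, x, by simp, hjx⟩
  -- The loop `e` adds no rank but lies in `N`. Conditioning on it removes the contribution of `meet
  -- N`, which was all that exempted this circuit.
  refine h.exists_eq_log (K := {e}) (i := x) (j := j) (l := y)
    (matroidRank_nonloop (hC.isNonloop_of_mem hnt (by simp))) ?_ ?_ ?_ ?_ ?_ ?_ ?_ hj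
    (Or.inr ⟨e, by simp, heN⟩)
  · rw [r _ (by simp), re]; simp
  · rw [r _ (by simp), re]; simp
  · rw [r _ (by simp), re]; simp
  · rw [r _ (by simp [Finset.insert_subset_iff]), re, Finset.card_pair hjy]; simp
  · rw [r _ (by simp [Finset.insert_subset_iff]), re, Finset.card_pair hjx]; simp
  · rw [r _ (by simp [Finset.insert_subset_iff]), re, Finset.card_pair hxy.symm]; simp
  · rw [Finset.pair_comm y x, r _ subset_rfl, re, h3]; simp

lemma rankOne_eq_meet (n n' : ℕ) :
    rankOne n n' = meet (Finset.univ.filter fun i : Fin n => (i : ℕ) < n') := by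
  funext A
  have : A ∩ Finset.univ.filter (fun i : Fin n => (i : ℕ) < n') =
      A.filter fun i : Fin n => (i : ℕ) < n' := by ext; simp
  rw [rankOne, meet, this]
  split_ifs with h
  · have := Finset.card_pos.2 h
    rw [min_eq_left (by omega), Nat.cast_one]
  · simp [Finset.not_nonempty_iff_eq_empty.1 h]

lemma meet_singleton_ne_zero {e : V} : meet N {e} ≠ 0 ↔ e ∈ N := by
  rw [meet]
  by_cases h : e ∈ N <;> simp [h]

end Main

theorem theorem11 (n n' : ℕ) (hn'_pos : 1 ≤ n') (hn'_le : n' ≤ n)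
    (M : Matroid (Fin n)) (hE : M.E = Set.univ)
    (hM : OnExtremeRay (matroidRank M))
    (hF : IsTwoDimFace (matroidRank M) (rankOne n n')) :
    -- all-entropic
    ((M.eRank = 1 ∨
        (IsEntropicRay (matroidRank M) ∧
          (∃ i : Fin n, ¬ M.IsLoop i ∧ rankOne n n' {i} ≠ 0) ∧
          ∀ C : Finset (Fin n), M.IsCircuit (C : Set (Fin n)) →
            IsTwoDimFace (restrictTo (matroidRank M) C) (restrictTo (rankOne n n') C) →
            IsAllEntropic (restrictTo (matroidRank M) C) (restrictTo (rankOne n n') C))) →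
      IsAllEntropic (matroidRank M) (rankOne n n')) ∧
    -- Matus type
    (((∃ C : Finset (Fin n), M.IsCircuit (C : Set (Fin n)) ∧
          IsMatusType (restrictTo (matroidRank M) C) (restrictTo (rankOne n n') C) ∧
          ∀ C' : Finset (Fin n), M.IsCircuit (C' : Set (Fin n)) → C' ≠ C →
            IsTwoDimFace (restrictTo (matroidRank M) C') (restrictTo (rankOne n n') C') →
            IsAllEntropic (restrictTo (matroidRank M) C') (restrictTo (rankOne n n') C')) ∧
        (∀ e : Fin n, M.IsLoop e → rankOne n n' {e} = 0)) →
      IsMatusType (matroidRank M) (rankOne n n')) ∧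
    -- Chen-Yeung type
    (((∃ C : Finset (Fin n), M.IsCircuit (C : Set (Fin n)) ∧
          IsChenYeungType (restrictTo (matroidRank M) C) (restrictTo (rankOne n n') C)) ∨
        ((∃ C : Finset (Fin n), M.IsCircuit (C : Set (Fin n)) ∧
            IsMatusType (restrictTo (matroidRank M) C) (restrictTo (rankOne n n') C)) ∧
          ∃ e : Fin n, M.IsLoop e ∧ rankOne n n' {e} ≠ 0)) →
      IsChenYeungType (matroidRank M) (rankOne n n')) := by
  rw [rankOne_eq_meet] at hF ⊢
  set N := Finset.univ.filter fun i : Fin n => (i : ℕ) < n'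
  refine ⟨?_, ?_, ?_⟩
  · rintro (h1 | ⟨hent, ⟨i, hi, hiN⟩, hC⟩)
    · exact isAllEntropic_matroidRank_of_eRank_eq_one hE h1
    · exact isAllEntropic_matroidRank hE hM hent ⟨i, hi, meet_singleton_ne_zero.1 hiN⟩ hC
  · rintro ⟨⟨C, hC, hCt, hC'⟩, hloop⟩
    exact isMatusType_matroidRank hE hM hF hC hCt hC' fun e he heN =>
      meet_singleton_ne_zero.2 heN (hloop e he)
  · intro h
    -- The entropic half holds for every pair: an entropic multiple of $M$ plus any multiple of $U$.
    refine ⟨fun v hv b hb =>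
      add_mem_entropyRegion hv.2 (smul_meet_mem_entropyRegion N hb.le), fun a b ha hb hv he => ?_⟩
    rcases h with ⟨C, -, hCt⟩ | ⟨⟨C, hC, hCt⟩, e, hel, heN⟩
    · exact hCt.2 a b ha hb hv (he.restriction C)
    · obtain ⟨m, hm, ham⟩ :=
        he.exists_eq_log_of_isLoop hC hCt hel (meet_singleton_ne_zero.1 heN)
      exact hv m hm ham
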